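/- Let $n\ge 1$ and $1\le m\le n$ be integers and let $K\in\{-1,+1\}$. Put $a=\infty$, $f(\rho)=\sinh^2\rho$, $\kappa(\rho)=\coth\rho$ if $K=-1$, and $a=\pi/2$, $f(\rho)=\sin^2\rho$, $\kappa(\rho)=\cot\rho$ if $K=+1$. Let $S^n$ be the unit sphere of $\mathbb R^{n+1}$ with its standard metric $e$, use spherical coordinates $(u,\rho)$, $u\in S^n$, $0<\rho<a$, and consider the metric $h=d\rho^2+f(\rho)\,e$ (hyperbolic space if $K=-1$, elliptic space if $K=+1$). For a positive function $z\in C^2(S^n)$ let $\lambda(z(u))=(\lambda_1(z(u)),\dots,\lambda_n(z(u)))$ be the principal curvatures, with respect to $h$ and the inner unit normal, of the hypersurface $\{(u,z(u)) : u\in S^n\}$ at the point $(u,z(u))$. Let $$H_m(\lambda)=\binom nm^{-1}\sum_{i_1<\dots<i_m}\lambda_{i_1}\cdots\lambda_{i_m},$$ and let $\Gamma_m$ be the connected component of $\{\lambda\in\mathbb R^n : H_m(\lambda)>0\}$ that contains the positive cone $\{\lambda : \lambda_1,\dots,\lambda_n>0\}$. The function $z$ (with values in $(0,a)$) is called $m$-admissible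 if $\lambda(z(u))\in\Gamma_m$ for every $u\in S^n$. **Lemma 4.1.** Let $0<R_1<R_2<a$ and let $\psi(u,\rho)$ be a positive smooth function on $S^n\times[R_1,R_2]$ such that $$\psi(u,R_1)\ge \kappa(R_1)^m\quad\text{and}\quad \psi(u,R_2)\le\kappa(R_2)^m\qquad\text{for all }u\in S^n .$$ Let $z$ be an $m$-admissible function with $R_1\le z(u)\le R_2$ for all $u\in S^n$ that solves $$H_m(\lambda(z(u)))=\psi(u,z(u))\qquad\text{for all }u\in S^n .$$ Then either $z\equiv R_1$ on $S^n$, or $z\equiv R_2$ on $S^n$, or $R_1<z(u)<R_2$ for all $u\in S^n$. -/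

import Mathlib

open scoped Manifold ContDiff

noncomputable section

/-- The Euclidean space `ℝⁿ⁺¹`. -/
abbrev Euc (n : ℕ) : Type := EuclideanSpace ℝ (Fin (n + 1))

/-- The unit sphere `Sⁿ` of `ℝⁿ⁺¹`, centred at the origin. -/
abbrev Sph (n : ℕ) : Type := Metric.sphere (0 : Euc n) 1

/-- The two space forms considered: hyperbolic space (sectional curvature `-1`) and elliptic
space (sectional curvature `+1`). -/
inductive SpaceForm : Type
  | hyperbolic
  | elliptic

namespace SpaceForm

/-- The function `f` in the metric `dρ² + f(ρ) e` on `Sⁿ × (0, a)`, where `e` is the standard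
metric of `Sⁿ`. -/
def warp : SpaceForm → ℝ → ℝ
  | hyperbolic, ρ => Real.sinh ρ ^ 2
  | elliptic, ρ => Real.sin ρ ^ 2

/-- The range `(0, a)` of the radial coordinate: `a = ∞` in the hyperbolic and `a = π / 2` in
the elliptic case. -/
def radii : SpaceForm → Set ℝ
  | hyperbolic => Set.Ioi 0
  | elliptic => Set.Ioo 0 (Real.pi / 2)

/-- `coth ρ` in the hyperbolic and `cot ρ` in the elliptic case. -/
def cotan : SpaceForm → ℝ → ℝ
  | hyperbolic, ρ => Real.cosh ρ / Real.sinh ρ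
  | elliptic, ρ => Real.cos ρ / Real.sin ρ

/-- The Riemannian metric `h = dρ² + f(ρ) e`, at the point `p = ρ u` of `ℝⁿ⁺¹ \ {0}` with
spherical coordinates `(u, ρ)`, `ρ = ‖p‖`, `u = p / ‖p‖`. A vector `v` at `p` has
`dρ(v) = ⟪v, u⟫`, and its component in `Sⁿ` is `du(v) = (v - ⟪v, u⟫ u) / ρ`, so that
`e(du(v), du(w)) = (⟪v, w⟫ - ⟪v, u⟫ ⟪w, u⟫) / ρ²`. -/
def metric (K : SpaceForm) {n : ℕ} (p v w : Euc n) : ℝ :=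
  let u : Euc n := ‖p‖⁻¹ • p
  inner ℝ v u * inner ℝ w u
    + K.warp ‖p‖ * ((inner ℝ v w - inner ℝ v u * inner ℝ w u) / ‖p‖ ^ 2)

/-- Christoffel symbols of the first kind of `h` in the Cartesian coordinates of `ℝⁿ⁺¹`: for
constant vector fields `v, w, y` this is `h(∇_v w, y)` at `p`, with `∇` the Levi-Civita connection
of `h` (Koszul formula). -/
def christoffel (K : SpaceForm) {n : ℕ} (p v w y : Euc n) : ℝ :=
  (1 / 2) * (fderiv ℝ (fun q => K.metric q w y) p v + fderiv ℝ (fun q => K.metric q v y) p w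
    - fderiv ℝ (fun q => K.metric q v w) p y)

end SpaceForm

open Classical in
/-- The parametrization `u ↦ (u, z(u)) = z(u) u` of the radial graph of `z` over `Sⁿ`, extended to
`ℝⁿ⁺¹ \ {0}` so as to be constant along rays from the origin (the value at `0` is irrelevant). -/
def radialGraph {n : ℕ} (z : Sph n → ℝ) (x : Euc n) : Euc n :=
  if hx : x = 0 then 0
  else z ⟨‖x‖⁻¹ • x, by
    rw [mem_sphere_zero_iff_norm, norm_smul, norm_inv, norm_norm,
      inv_mul_cancel₀ (norm_ne_zero_iff.mpr hx)]⟩ • (‖x‖⁻¹ • x)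

/-- The first fundamental form of the radial graph of `z`, on vectors `ξ, η` tangent to `Sⁿ` at
`u`. -/
def firstForm (K : SpaceForm) {n : ℕ} (z : Sph n → ℝ) (u : Sph n) (ξ η : Euc n) : ℝ :=
  K.metric (z u • (u : Euc n)) (fderiv ℝ (radialGraph z) u ξ) (fderiv ℝ (radialGraph z) u η)

/-- `N` is the unit normal, with respect to `h`, of the radial graph of `z` at the point over `u`,
pointing inward (towards the origin). -/
structure IsInnerUnitNormal (K : SpaceForm) {n : ℕ} (z : Sph n → ℝ) (u : Sph n) (N : Euc n) :
    Prop where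
  unit : K.metric (z u • (u : Euc n)) N N = 1
  normal : ∀ ξ : Euc n, inner ℝ (u : Euc n) ξ = 0 →
    K.metric (z u • (u : Euc n)) (fderiv ℝ (radialGraph z) u ξ) N = 0
  inward : K.metric (z u • (u : Euc n)) N u < 0

/-- The second fundamental form of the radial graph of `z` with respect to the normal `N`, on
vectors `ξ, η` tangent to `Sⁿ` at `u`. With `r` the parametrization of the graph it is
`h(∇_ξ (dr η), N)`, where `∇_ξ (dr η) = D²r(ξ, η) + Γ(dr ξ, dr η)` is the covariant derivative along
`r` in the ambient space. As `r` is constant along rays, a change of the extension of `η` off `u`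
changes `∇_ξ (dr η)` by a vector tangent to the graph only, which `h(·, N)` annihilates. -/
def secondForm (K : SpaceForm) {n : ℕ} (z : Sph n → ℝ) (u : Sph n) (N ξ η : Euc n) : ℝ :=
  K.metric (z u • (u : Euc n)) (fderiv ℝ (fderiv ℝ (radialGraph z)) u ξ η) N
    + K.christoffel (z u • (u : Euc n)) (fderiv ℝ (radialGraph z) u ξ)
        (fderiv ℝ (radialGraph z) u η) N

/-- `l = (λ₁, …, λₙ)` lists, with multiplicity and in any order, the principal curvatures of the
radial graph of `z` at the point over `u` with respect to the inner normal: the eigenvalues of the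
second fundamental form relative to the first one. That is, some basis of the tangent space of `Sⁿ`
at `u` is orthonormal for the first form and diagonalizes the second with diagonal `l`. -/
def IsPrincipalCurvatures (K : SpaceForm) {n : ℕ} (z : Sph n → ℝ) (u : Sph n)
    (l : Fin n → ℝ) : Prop :=
  ∃ (N : Euc n) (e : Fin n → Euc n), IsInnerUnitNormal K z u N ∧
    (∀ i, inner ℝ (u : Euc n) (e i) = 0) ∧
    (∀ i j, firstForm K z u (e i) (e j) = if i = j then 1 else 0) ∧
    (∀ i j, secondForm K z u N (e i) (e j) = if i = j then l i else 0)

/-- The normalized elementary symmetric function `H_m` of order `m`. -/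
def meanCurv {n : ℕ} (m : ℕ) (l : Fin n → ℝ) : ℝ :=
  ((n.choose m : ℕ) : ℝ)⁻¹ * ∑ s ∈ Finset.powersetCard m (Finset.univ : Finset (Fin n)), ∏ i ∈ s, l i

/-- The cone `Γ_m`: the connected component of `{H_m > 0}` that contains the (connected) positive
cone, that is, the component of the point `(1, …, 1)`. -/
def gammaCone (n m : ℕ) : Set (Fin n → ℝ) :=
  connectedComponentIn {l : Fin n → ℝ | 0 < meanCurv m l} (fun _ => 1)

/-- `m`-admissible functions for the operator `H_m`. -/
structure IsAdmissible (K : SpaceForm) {n : ℕ} (m : ℕ) (z : Sph n → ℝ) : Prop where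
  contMDiff : ContMDiff (𝓡 n) 𝓘(ℝ, ℝ) 2 z
  pos : ∀ u, 0 < z u
  mem_cone : ∀ u, ∃ l, IsPrincipalCurvatures K z u l ∧ l ∈ gammaCone n m

/-- The equation `H_m(λ(z(u))) = ψ(u, z(u))` on `Sⁿ`. It does not depend on the order in which the
principal curvatures are listed. -/
def SolvesCurvatureEq (K : SpaceForm) {n : ℕ} (m : ℕ) (ψ : Sph n → ℝ → ℝ) (z : Sph n → ℝ) : Prop :=
  ∀ u, ∃ l, IsPrincipalCurvatures K z u l ∧ meanCurv m l = ψ u (z u)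

end

/-! This is a strong maximum principle: a solution touching one of the barrier spheres `ρ = R`
coincides with it. Put `w = σ (z - R) ≥ 0`, with `σ = 1` at `R₁` and `σ = -1` at `R₂`, and suppose
that `w` vanishes somewhere but not everywhere. As in Hopf's argument, `w` is touched from below at
some `u` by a small barrier `ε exp (α ⟨v, p⟩)`, up to an additive constant. The touching point stays
away from `± p` by an amount `δ` independent of `α`. With `g` the factor `ε α exp (α ⟨u, p⟩)`, the
gradient of `w` at `u` is `g ⟨·, p⟩`, the trace of its Hessian in an orthonormal frame of the graph
is at least of order `g (α δ - const)`, and `w u ≤ g`.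

The zero-order error is harmless: `ψ` is Lipschitz in `ρ` near `R`, so it moves by at most `C g`
from its value at `R`, while `κ` is decreasing and changes in the favourable direction. For `α`
large the trace term beats `C g`, which contradicts the equation at the single point `u`. No
linearization of `H_m` is needed.

The two spheres are treated differently. At `R₂` each principal curvature is bounded below by `κ (1
+ x i)` with small `x i`; there `H_m` is monotone and has an explicit first-order lower bound
(`le_meanCurv_of_abs_le`, `exists_add_le_meanCurv`), and the cone `Γ_m` plays no role. At `R₁` the
curvatures are only bounded above and may be far from equal; Maclaurin's inequality `H_m ≤ H_1 ^ m`
on `Γ_m` reduces the comparison to the trace (`meanCurv_le_meanCurv_one_pow`,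
`exists_meanCurv_one_pow_lt`). `IsPrincipalCurvatures.bounds_of_touching` carries the barrier into
geometry. -/

noncomputable section

/-! ### Symmetric means, the cone `Γ_m` and Maclaurin's inequality -/

open Polynomial in
/-- The symmetric means of order at most `m` of `n` real numbers are the symmetric means of suitable
`m` real numbers. -/
theorem exists_esymm_eq_meanCurv {n m : ℕ} (hmn : m ≤ n) (l : Fin n → ℝ) :
    ∃ s : Multiset ℝ, Multiset.card s = m ∧
      ∀ k ≤ m, s.esymm k = (m.choose k : ℝ) * meanCurv k l := by
  set P : ℝ[X] := ∏ i, (X + C (l i)) with hP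
  have hPmonic : P.Monic := monic_prod_of_monic _ _ fun i _ => monic_X_add_C _
  have hPdeg : P.natDegree = n := by
    rw [hP, natDegree_prod_of_monic _ _ fun i _ => monic_X_add_C _]; simp
  have hProots : Multiset.card P.roots = n := by
    have : P.Splits := Splits.prod fun i _ => Splits.X_add_C _
    rw [splits_iff_card_roots.1 this, hPdeg]
  -- Rolle's theorem: each differentiation loses at most one real root, counted with multiplicity,
  -- so all derivatives of `P` remain real-rooted.
  have hiter : ∀ k, n ≤ Multiset.card (derivative^[k] P).roots + k := by
    intro k
    induction k with
    | zero => simp [hProots]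
    | succ k ih =>
      have := card_roots_le_derivative (derivative^[k] P)
      rw [Function.iterate_succ_apply']
      omega
  set q := derivative^[n - m] P with hq
  have hcoeff : ∀ k ≤ m, q.coeff (m - k) =
      (n.descFactorial (n - m) : ℝ) * ((m.choose k : ℝ) * meanCurv k l) := by
    intro k hk
    have e1 : m - k + (n - m) = n - k := by omega
    have hch : ((n.choose k : ℕ) : ℝ) ≠ 0 :=
      Nat.cast_ne_zero.2 (Nat.choose_pos (hk.trans hmn)).ne'
    have e2 : ((n - k).descFactorial (n - m) : ℝ) * n.choose k
        = n.descFactorial (n - m) * m.choose k := by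
      have h1 := Nat.factorial_mul_descFactorial (show n - m ≤ n - k by omega)
      have h2 := Nat.factorial_mul_descFactorial (show n - m ≤ n by omega)
      have h3 := Nat.choose_mul_factorial_mul_factorial hk
      have h4 := Nat.choose_mul_factorial_mul_factorial (hk.trans hmn)
      rw [show n - k - (n - m) = m - k by omega] at h1
      rw [show n - (n - m) = m by omega] at h2
      have : (m - k).factorial * k.factorial * ((n - k).descFactorial (n - m) * n.choose k)
          = (m - k).factorial * k.factorial * (n.descFactorial (n - m) * m.choose k) := by
        calc _ = n.choose k * k.factorial * ((m - k).factorial * (n - k).descFactorial (n - m)) := by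
              ring
          _ = m.choose k * k.factorial * (m - k).factorial * n.descFactorial (n - m) := by
              rw [h1, h4, h3, h2]
          _ = _ := by ring
      exact_mod_cast Nat.eq_of_mul_eq_mul_left (by positivity) this
    rw [hq, coeff_iterate_derivative, e1, hP,
      Finset.prod_X_add_C_coeff _ _ (by simp), Finset.card_univ, Fintype.card_fin,
      show n - (n - k) = k by omega, ← mul_assoc, ← e2, nsmul_eq_mul, meanCurv]
    field_simp
  have hd : (n.descFactorial (n - m) : ℝ) ≠ 0 := by
    rw [Nat.cast_ne_zero]
    exact (Nat.descFactorial_pos.2 (by omega)).ne'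
  have hqdeg : q.natDegree ≤ m := by
    have := natDegree_iterate_derivative P (n - m)
    rw [hPdeg, ← hq] at this; omega
  have hqcard : Multiset.card q.roots = m := by
    have h1 := hiter (n - m)
    have h2 := card_roots' q
    rw [← hq] at h1; omega
  have hqdeg' : q.natDegree = m := le_antisymm hqdeg (hqcard ▸ card_roots' q)
  have hlead : q.leadingCoeff = n.descFactorial (n - m) := by
    have := hcoeff 0 (Nat.zero_le _)
    rw [leadingCoeff, hqdeg']
    simpa [meanCurv] using this
  -- `q` is a constant times `∏ (X + r)` over its negated roots `r`, so its coefficients are both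
  -- that constant times the `esymm` of the `r` and, by `hcoeff`, multiples of the means of `l`.
  refine ⟨q.roots.map Neg.neg, by simp [hqcard], fun k hk => ?_⟩
  have h1 := C_leadingCoeff_mul_prod_multiset_X_sub_C (hqcard.trans hqdeg'.symm)
  have h2 : (q.roots.map fun a => X - C a) = (q.roots.map Neg.neg).map fun r => X + C r := by
    simp [Multiset.map_map, sub_eq_add_neg]
  have h3 := hcoeff k hk
  rw [← h1, hlead, coeff_C_mul, h2, Multiset.prod_X_add_C_coeff _ (by simp [hqcard])] at h3
  have h4 := mul_left_cancel₀ hd h3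
  rwa [Multiset.card_map, hqcard, show m - (m - k) = k by omega] at h4

/-- The arithmetic-geometric mean inequality for multisets. -/
theorem Multiset.prod_le_pow_of_sum_eq {s : Multiset ℝ} (hs : ∀ r ∈ s, 0 < r) {A : ℝ} (hA : 0 < A)
    (hsum : s.sum = Multiset.card s * A) : s.prod ≤ A ^ Multiset.card s := by
  -- Multiply the inequalities `a ≤ A exp (a / A - 1)`; the total exponent vanishes when the mean is
  -- `A`.
  have key : ∀ t : Multiset ℝ, (∀ r ∈ t, 0 < r) →
      0 ≤ t.prod ∧ t.prod ≤ A ^ Multiset.card t * Real.exp (t.sum / A - Multiset.card t) := by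
    intro t
    induction t using Multiset.induction_on with
    | empty => simp
    | cons a t ih =>
      intro h
      have ha := h a (Multiset.mem_cons_self a t)
      obtain ⟨h0, h1⟩ := ih fun r hr => h r (Multiset.mem_cons_of_mem hr)
      have h2 : a ≤ A * Real.exp (a / A - 1) := by
        have := Real.add_one_le_exp (a / A - 1)
        rw [sub_add_cancel, div_le_iff₀ hA] at this
        linarith
      rw [Multiset.prod_cons, Multiset.sum_cons, Multiset.card_cons]
      refine ⟨by positivity, (mul_le_mul h2 h1 h0 (by positivity)).trans_eq ?_⟩
      rw [show (a + t.sum) / A - ((Multiset.card t + 1 : ℕ) : ℝ)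
        = (a / A - 1) + (t.sum / A - Multiset.card t) by push_cast; ring, Real.exp_add, pow_succ]
      ring
  have := (key s hs).2
  rwa [hsum, mul_div_cancel_right₀ _ hA.ne', sub_self, Real.exp_zero, mul_one] at this

theorem Multiset.esymm_pos {s : Multiset ℝ} (hs : ∀ r ∈ s, 0 < r) {k : ℕ}
    (hk : k ≤ Multiset.card s) : 0 < s.esymm k := by
  rw [Multiset.esymm]
  have hpos : ∀ x ∈ (s.powersetCard k).map Multiset.prod, 0 < x := by
    intro x hx
    obtain ⟨t, ht, rfl⟩ := Multiset.mem_map.1 hx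
    have hts := (Multiset.mem_powersetCard.1 ht).1
    exact Multiset.prod_induction (fun x : ℝ => 0 < x) t (fun _ _ => mul_pos) one_pos
      fun r hr => hs r (Multiset.mem_of_le hts hr)
  have hne : (s.powersetCard k).map Multiset.prod ≠ 0 := by
    rw [← Multiset.card_pos, Multiset.card_map, Multiset.card_powersetCard]
    exact Nat.choose_pos hk
  obtain ⟨a, ha⟩ := Multiset.exists_mem_of_ne_zero hne
  obtain ⟨t, ht⟩ := Multiset.exists_cons_of_mem ha
  rw [ht, Multiset.sum_cons]
  refine add_pos_of_pos_of_nonneg (hpos a ha) (Multiset.sum_nonneg fun x hx => (hpos x ?_).le)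
  rw [ht]; exact Multiset.mem_cons_of_mem hx

-- At a root `-r ≥ 0` of `∏ (X + r)` the expansion in elementary symmetric functions is a sum of
-- nonnegative terms, so every term vanishes, including the constant one, which is positive.
open Polynomial in
theorem Multiset.pos_of_esymm_nonneg {s : Multiset ℝ} (h : ∀ k ≤ Multiset.card s, 0 ≤ s.esymm k)
    (h' : 0 < s.esymm (Multiset.card s)) : ∀ r ∈ s, 0 < r := by
  intro r hr
  by_contra! hle
  have h0 : ((s.map fun r => X + C r).prod).eval (-r) = 0 := by
    rw [eval_multiset_prod, Multiset.prod_eq_zero]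
    simp only [Multiset.map_map, Multiset.mem_map]
    exact ⟨r, hr, by simp⟩
  rw [Multiset.prod_X_add_C_eq_sum_esymm, eval_finsetSum] at h0
  simp only [eval_mul, eval_C, eval_pow, eval_X] at h0
  have hnn : ∀ j ∈ Finset.range (Multiset.card s + 1),
      0 ≤ s.esymm j * (-r) ^ (Multiset.card s - j) := fun j hj =>
    mul_nonneg (h j (by simpa [Nat.lt_succ_iff] using hj)) (pow_nonneg (by linarith) _)
  have := (Finset.sum_eq_zero_iff_of_nonneg hnn).1 h0 (Multiset.card s) (by simp)
  simp at this
  linarith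

theorem continuous_meanCurv {n : ℕ} (k : ℕ) : Continuous (meanCurv k : (Fin n → ℝ) → ℝ) := by
  unfold meanCurv; fun_prop

/-- If the symmetric means of order at most `m` are nonnegative and that of order `m` is positive,
then all of them are positive. -/
theorem meanCurv_pos_of_nonneg {n m : ℕ} (hmn : m ≤ n) {l : Fin n → ℝ}
    (h : ∀ k ≤ m, 0 ≤ meanCurv k l) (h' : 0 < meanCurv m l) :
    (∀ k ≤ m, 0 < meanCurv k l) ∧ (1 ≤ m → meanCurv m l ≤ meanCurv 1 l ^ m) := by
  obtain ⟨s, hs, hsk⟩ := exists_esymm_eq_meanCurv hmn l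
  have hpos : ∀ r ∈ s, 0 < r := by
    refine Multiset.pos_of_esymm_nonneg (fun k hk => ?_) ?_
    · rw [hsk k (hs ▸ hk)]
      exact mul_nonneg (Nat.cast_nonneg _) (h k (hs ▸ hk))
    · rw [hs, hsk m le_rfl]; simpa using h'
  have hall : ∀ k ≤ m, 0 < meanCurv k l := by
    intro k hk
    have := Multiset.esymm_pos hpos (hs.symm ▸ hk)
    rw [hsk k hk] at this
    exact pos_of_mul_pos_right this (Nat.cast_nonneg _)
  refine ⟨hall, fun hm => ?_⟩
  have h1 := hsk 1 hm
  have hm' := hsk m le_rfl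
  have hsum : s.esymm 1 = s.sum := by
    simp [Multiset.esymm, Multiset.powersetCard_one]
  have hprod : s.esymm m = s.prod := by
    rw [Multiset.esymm, ← hs, Multiset.powersetCard_self]; simp
  rw [hprod] at hm'
  rw [hsum] at h1
  have := Multiset.prod_le_pow_of_sum_eq hpos (hall 1 hm) (by rw [h1, hs, Nat.choose_one_right])
  rw [hs, hm'] at this
  simpa using this

theorem meanCurv_const {n k : ℕ} (hk : k ≤ n) (c : ℝ) :
    meanCurv k (fun _ : Fin n => c) = c ^ k := by
  have : ((n.choose k : ℕ) : ℝ) ≠ 0 := Nat.cast_ne_zero.2 (Nat.choose_pos hk).ne'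
  rw [meanCurv, Finset.sum_congr rfl (g := fun _ => c ^ k)]
  · simp; field_simp
  · intro s hs
    rw [Finset.prod_const, (Finset.mem_powersetCard.1 hs).2]

/-- On the cone `Γ_m` the symmetric means of order at most `m` are positive. -/
theorem meanCurv_pos_of_mem_gammaCone {n m : ℕ} (hmn : m ≤ n) {l : Fin n → ℝ}
    (hl : l ∈ gammaCone n m) : ∀ k ≤ m, 0 < meanCurv k l := by
  set U := {l : Fin n → ℝ | 0 < meanCurv m l}
  set O₁ := {l : Fin n → ℝ | ∀ k ≤ m, 0 < meanCurv k l}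
  set O₂ := {l : Fin n → ℝ | ∃ k ≤ m, meanCurv k l < 0}
  have hO₁ : IsOpen O₁ := by
    have : O₁ = ⋂ k ∈ Set.Iic m, {l | 0 < meanCurv k l} := by ext; simp [O₁]
    rw [this]
    exact (Set.finite_Iic m).isOpen_biInter fun k _ =>
      isOpen_lt continuous_const (continuous_meanCurv k)
  have hO₂ : IsOpen O₂ := by
    have : O₂ = ⋃ k ∈ Set.Iic m, {l | meanCurv k l < 0} := by ext; simp [O₂]
    rw [this]
    exact isOpen_biUnion fun k _ => isOpen_lt (continuous_meanCurv k) continuous_const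
  have hdisj : Disjoint O₁ O₂ := by
    rw [Set.disjoint_left]
    rintro x hx ⟨k, hk, hk'⟩
    exact (hx k hk).not_gt hk'
  have hone : (fun _ => 1 : Fin n → ℝ) ∈ U := by
    simp only [U, Set.mem_ofPred_eq, meanCurv_const hmn]; simp
  have hone₁ : (fun _ => 1 : Fin n → ℝ) ∈ O₁ := fun k hk => by
    rw [meanCurv_const (hk.trans hmn)]; simp
  -- Inside `U` nonnegativity of the lower means already forces positivity, so the open sets `O₁`
  -- and `O₂` cover `U` and the component of `(1, …, 1)` cannot leave `O₁`.
  refine (isPreconnected_connectedComponentIn.subset_left_of_subset_union hO₁ hO₂ hdisj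
    (fun x hx => ?_) ⟨_, mem_connectedComponentIn hone, hone₁⟩) hl
  have hxU : x ∈ U := connectedComponentIn_subset _ _ hx
  by_cases h : x ∈ O₂
  · exact Or.inr h
  · refine Or.inl (meanCurv_pos_of_nonneg hmn (fun k hk => ?_) hxU).1
    by_contra! hlt
    exact h ⟨k, hk, hlt⟩

/-- Maclaurin's inequality on the cone `Γ_m`. -/
theorem meanCurv_le_meanCurv_one_pow {n m : ℕ} (hm : 1 ≤ m) (hmn : m ≤ n) {l : Fin n → ℝ}
    (hl : l ∈ gammaCone n m) : meanCurv m l ≤ meanCurv 1 l ^ m := by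
  have h := meanCurv_pos_of_mem_gammaCone hmn hl
  exact (meanCurv_pos_of_nonneg hmn (fun k hk => (h k hk).le) (h m le_rfl)).2 hm

theorem meanCurv_one {n : ℕ} (l : Fin n → ℝ) : meanCurv 1 l = (n : ℝ)⁻¹ * ∑ i, l i := by
  simp [meanCurv, Finset.powersetCard_one]

theorem meanCurv_mono {n m : ℕ} {l l' : Fin n → ℝ} (h0 : ∀ i, 0 ≤ l i) (h : ∀ i, l i ≤ l' i) :
    meanCurv m l ≤ meanCurv m l' := by
  unfold meanCurv
  gcongr with s hs i hi
  · exact fun i _ => h0 i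
  · exact h i

/-! ### First-order lower bound for `H_m` near the diagonal -/

/-- Apply `exp (-t) ≥ 1 - t` with `t = x - 2 x ^ 2` and note `(1 + x) (1 - x + 2 x ^ 2) = 1 + x ^ 2
(1 + 2 x) ≥ 1`. The bound turns products of factors `1 + x i` into exponentials of sums. -/
theorem exp_sub_two_mul_sq_le {x : ℝ} (hx : |x| ≤ 1 / 2) : Real.exp (x - 2 * x ^ 2) ≤ 1 + x := by
  obtain ⟨h1, h2⟩ := abs_le.1 hx
  have h3 : 0 < 1 - x + 2 * x ^ 2 := by nlinarith
  have h4 := Real.add_one_le_exp (-(x - 2 * x ^ 2))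
  have h5 : Real.exp (x - 2 * x ^ 2) * Real.exp (-(x - 2 * x ^ 2)) = 1 := by
    rw [← Real.exp_add]; simp
  have h6 : Real.exp (x - 2 * x ^ 2) * (1 - x + 2 * x ^ 2) ≤ 1 := by
    rw [← h5]; gcongr; linarith
  have h7 : 1 ≤ (1 + x) * (1 - x + 2 * x ^ 2) := by
    nlinarith [mul_nonneg (sq_nonneg x) (show 0 ≤ 1 + 2 * x by linarith)]
  exact le_of_mul_le_mul_right (h6.trans h7) h3

/-- Double counting: each index lies in `(n - 1).choose (m - 1)` of the subsets. -/
theorem sum_powersetCard_sum {n m : ℕ} (hm : 1 ≤ m) (y : Fin n → ℝ) :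
    ∑ s ∈ Finset.powersetCard m (Finset.univ : Finset (Fin n)), ∑ i ∈ s, y i
      = ((n - 1).choose (m - 1) : ℝ) * ∑ i, y i := by
  classical
  have h1 : ∀ s ∈ Finset.powersetCard m (Finset.univ : Finset (Fin n)),
      ∑ i ∈ s, y i = ∑ i, if i ∈ s then y i else 0 := fun s _ => by
    simp
  rw [Finset.sum_congr rfl h1, Finset.sum_comm, Finset.mul_sum]
  refine Finset.sum_congr rfl fun i _ => ?_
  have h2 := Finset.card_filter_powersetCard_subset {i} (Finset.univ : Finset (Fin n)) m
    (Finset.subset_univ _) (by simpa using hm)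
  rw [← Finset.sum_filter, Finset.sum_const, nsmul_eq_mul]
  simp only [Finset.singleton_subset_iff, Finset.card_univ, Fintype.card_fin,
    Finset.card_singleton] at h2
  rw [h2]

/-- A quantitative first-order lower bound for `H_m` near the diagonal. -/
theorem le_meanCurv_of_abs_le {n m : ℕ} (hm : 1 ≤ m) (hmn : m ≤ n) {c : ℝ} (hc : 0 ≤ c)
    {x : Fin n → ℝ} (hx : ∀ i, |x i| ≤ 1 / 2) :
    c ^ m * (1 + (m / n : ℝ) * ∑ i, (x i - 2 * x i ^ 2)) ≤ meanCurv m fun i => c * (1 + x i) := by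
  have hch : (0 : ℝ) < (n.choose m : ℕ) := Nat.cast_pos.2 (Nat.choose_pos hmn)
  have hn : (0 : ℝ) < n := Nat.cast_pos.2 (by omega)
  have h1 : ∀ s ∈ Finset.powersetCard m (Finset.univ : Finset (Fin n)),
      c ^ m * (1 + ∑ i ∈ s, (x i - 2 * x i ^ 2)) ≤ ∏ i ∈ s, c * (1 + x i) := by
    intro s hs
    rw [Finset.prod_mul_distrib, Finset.prod_const, (Finset.mem_powersetCard.1 hs).2]
    gcongr
    calc 1 + ∑ i ∈ s, (x i - 2 * x i ^ 2) ≤ Real.exp (∑ i ∈ s, (x i - 2 * x i ^ 2)) := by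
          linarith [Real.add_one_le_exp (∑ i ∈ s, (x i - 2 * x i ^ 2))]
      _ = ∏ i ∈ s, Real.exp (x i - 2 * x i ^ 2) := Real.exp_sum _ _
      _ ≤ _ := by
          refine Finset.prod_le_prod (fun i _ => (Real.exp_pos _).le) fun i _ => ?_
          exact exp_sub_two_mul_sq_le (hx i)
  have h2 := Finset.sum_le_sum h1
  rw [← Finset.mul_sum, Finset.sum_add_distrib, sum_powersetCard_sum hm] at h2
  rw [meanCurv, inv_mul_eq_div, le_div_iff₀ hch]
  refine le_of_eq_of_le ?_ h2
  have h3 : (n : ℝ) * ((n - 1).choose (m - 1) : ℝ) = n.choose m * m := by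
    have := Nat.add_one_mul_choose_eq (n - 1) (m - 1)
    rw [Nat.sub_add_cancel (hm.trans hmn), Nat.sub_add_cancel hm] at this
    exact_mod_cast this
  simp only [Finset.sum_const, Finset.card_powersetCard, Finset.card_univ, Fintype.card_fin,
    nsmul_eq_mul, mul_one]
  generalize ∑ i, (x i - 2 * x i ^ 2) = y
  field_simp
  linear_combination (-(y * c ^ m)) * h3

/-! ### Calculus on the sphere through extension along rays -/

open Filter Topology

open Classical in
/-- The radial projection onto the unit sphere (with an irrelevant value at the origin). -/
def sphProj {n : ℕ} (x : Euc n) : Sph n :=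
  if hx : x = 0 then ⟨EuclideanSpace.single 0 1, by simp⟩
  else ⟨‖x‖⁻¹ • x, by
    rw [mem_sphere_zero_iff_norm, norm_smul, norm_inv, norm_norm,
      inv_mul_cancel₀ (norm_ne_zero_iff.mpr hx)]⟩

theorem coe_sphProj {n : ℕ} {x : Euc n} (hx : x ≠ 0) : (sphProj x : Euc n) = ‖x‖⁻¹ • x := by
  simp [sphProj, hx]

theorem sphProj_coe {n : ℕ} (u : Sph n) : sphProj (u : Euc n) = u := by
  have hu : ‖(u : Euc n)‖ = 1 := by simp
  have : (u : Euc n) ≠ 0 := norm_ne_zero_iff.1 (by simp)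
  ext1
  rw [coe_sphProj this, hu]; simp

theorem radialGraph_eq {n : ℕ} (z : Sph n → ℝ) (x : Euc n) :
    radialGraph z x = z (sphProj x) • (‖x‖⁻¹ • x) := by
  by_cases hx : x = 0
  · simp [radialGraph, hx]
  · simp [radialGraph, sphProj, hx]

/-- The chart of the sphere at `v` is the stereographic projection from `-v`, which is the
restriction of a map smooth in the ambient space near `v`; composing it with `x / ‖x‖` stays in
Euclidean space. -/
theorem contMDiffAt_sphProj {n : ℕ} {x : Euc n} (hx : x ≠ 0) :
    ContMDiffAt 𝓘(ℝ, Euc n) (𝓡 n) 2 (sphProj : Euc n → Sph n) x := by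
  have hev : (fun y => ‖y‖⁻¹ • y) =ᶠ[𝓝 x] fun y => (sphProj y : Euc n) := by
    filter_upwards [isOpen_ne.mem_nhds hx] with y hy using (coe_sphProj hy).symm
  have hcd : ContDiffAt ℝ 2 (fun y => (sphProj y : Euc n)) x := by
    refine ContDiffAt.congr_of_eventuallyEq ?_ hev.symm
    exact ((contDiffAt_norm ℝ hx).inv (norm_ne_zero_iff.2 hx)).smul contDiffAt_id
  have : Fact (Module.finrank ℝ (Euc n) = n + 1) := ⟨finrank_euclideanSpace_fin⟩
  rw [contMDiffAt_iff_target]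
  refine ⟨Topology.IsInducing.subtypeVal.continuousAt_iff.2 hcd.continuousAt, ?_⟩
  set v := sphProj x
  let U : _ ≃ₗᵢ[ℝ] _ :=
    (OrthonormalBasis.fromOrthogonalSpanSingleton
        n (ne_zero_of_mem_unit_sphere (-v))).repr
  have h1 : ContDiffAt ℝ 2 (stereoToFun (-v : Euc n)) (v : Euc n) := by
    have hopen : IsOpen {y : Euc n | innerSL ℝ (-v : Euc n) y ≠ (1 : ℝ)} :=
      isOpen_ne_fun (by fun_prop) continuous_const
    refine (contDiffOn_stereoToFun.contDiffAt (hopen.mem_nhds ?_)).of_le le_top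
    simp only [Set.mem_ofPred_eq, innerSL_apply_apply, inner_neg_left, real_inner_self_eq_norm_sq]
    simp; norm_num
  have h2 : ContDiffAt ℝ 2 (fun y => U (stereoToFun (-v : Euc n) (sphProj y : Euc n))) x :=
    U.contDiff.contDiffAt.comp x
      (ContDiffAt.comp (f := fun y => (sphProj y : Euc n)) x h1 hcd)
  refine h2.contMDiffAt.congr_of_eventuallyEq (Eventually.of_forall fun y => ?_)
  rfl

/-- This allows ordinary Fréchet derivatives of the extension of `z` to replace derivatives on the
sphere. -/
theorem ContMDiff.contDiffAt_comp_sphProj {n : ℕ} {z : Sph n → ℝ}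
    (hz : ContMDiff (𝓡 n) 𝓘(ℝ, ℝ) 2 z) {x : Euc n} (hx : x ≠ 0) :
    ContDiffAt ℝ 2 (fun y => z (sphProj y)) x :=
  contMDiffAt_iff_contDiffAt.1 ((hz _).comp x (contMDiffAt_sphProj hx))

/-- First and second derivatives along a line. -/
theorem ContDiffAt.hasDerivAt_line {E G : Type*} [NormedAddCommGroup E] [NormedSpace ℝ E]
    [NormedAddCommGroup G] [NormedSpace ℝ G] {F : E → G} {x : E} (hF : ContDiffAt ℝ 2 F x) (ξ : E) :
    (∀ᶠ t in 𝓝 (0 : ℝ), HasDerivAt (fun t : ℝ => F (x + t • ξ)) (fderiv ℝ F (x + t • ξ) ξ) t) ∧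
      HasDerivAt (fun t : ℝ => fderiv ℝ F (x + t • ξ) ξ) (fderiv ℝ (fderiv ℝ F) x ξ ξ) 0 := by
  have hline : ∀ t : ℝ, HasDerivAt (fun t : ℝ => x + t • ξ) ξ t := fun t => by
    simpa using ((hasDerivAt_id t).smul_const ξ).const_add x
  have hcont : Tendsto (fun t : ℝ => x + t • ξ) (𝓝 0) (𝓝 x) := by
    simpa using (hline 0).continuousAt.tendsto
  constructor
  · have h1 : ∀ᶠ y in 𝓝 x, DifferentiableAt ℝ F y := by
      have := hF.eventually (by simp)
      filter_upwards [this] with y hy using hy.differentiableAt (by norm_num)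
    filter_upwards [hcont.eventually h1] with t ht
    exact ht.hasFDerivAt.comp_hasDerivAt t (hline t)
  · have h2 : DifferentiableAt ℝ (fderiv ℝ F) x :=
      (hF.fderiv_right (m := 1) (by norm_num)).differentiableAt (by norm_num)
    have h3 : HasFDerivAt (fderiv ℝ F) (fderiv ℝ (fderiv ℝ F) x) (x + (0 : ℝ) • ξ) := by
      simpa using h2.hasFDerivAt
    have h4 := h3.comp_hasDerivAt (0 : ℝ) (hline 0)
    exact ((ContinuousLinearMap.apply ℝ G ξ).hasFDerivAt.comp_hasDerivAt (0 : ℝ) h4)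

/-- The necessary condition of second order at a local minimum. -/
theorem IsLocalMin.nonneg_of_hasDerivAt {f f' : ℝ → ℝ} {f'' x : ℝ} (h : IsLocalMin f x)
    (hf : ∀ᶠ t in 𝓝 x, HasDerivAt f (f' t) t) (hf' : HasDerivAt f' f'' x) :
    f' x = 0 ∧ 0 ≤ f'' := by
  have h0 : f' x = 0 := h.hasDerivAt_eq_zero hf.self_of_nhds
  refine ⟨h0, ?_⟩
  by_contra! hneg
  have hd : deriv f =ᶠ[𝓝 x] f' := hf.mono fun t ht => ht.deriv
  have hdd : deriv (deriv f) x = f'' := by rw [hd.deriv_eq, hf'.deriv]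
  have hmax := isLocalMax_of_deriv_deriv_neg (by rw [hdd]; exact hneg)
    (by rw [hd.self_of_nhds, h0]) hf.self_of_nhds.continuousAt
  -- A point that is both a local minimum and a local maximum has `f` constant nearby, so the second
  -- derivative would be zero rather than negative.
  have hconst : f =ᶠ[𝓝 x] fun _ => f x := by
    filter_upwards [h, hmax] with t h1 h2 using le_antisymm h2 h1
  have h1 : deriv f =ᶠ[𝓝 x] fun _ => 0 := by
    filter_upwards [hconst.eventuallyEq_nhds] with t ht
    rw [ht.deriv_eq]; simp
  have : deriv (deriv f) x = 0 := by rw [h1.deriv_eq]; simp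
  linarith [hdd]

section Line

variable {n : ℕ} {u : Sph n} {ξ : Euc n}

theorem norm_add_smul_eq_sqrt (hξ : inner ℝ (u : Euc n) ξ = 0) (t : ℝ) :
    ‖(u : Euc n) + t • ξ‖ = √(1 + t ^ 2 * ‖ξ‖ ^ 2) := by
  rw [← Real.sqrt_sq (norm_nonneg ((u : Euc n) + t • ξ)), norm_add_sq_real, inner_smul_right, hξ,
    norm_smul, mul_pow]
  simp

theorem hasDerivAt_inv_sqrt (a t : ℝ) (ha : 0 ≤ a) :
    HasDerivAt (fun t : ℝ => (√(1 + t ^ 2 * a))⁻¹) (-(t * a) * (√(1 + t ^ 2 * a))⁻¹ ^ 3) t := by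
  have hpos : 0 < 1 + t ^ 2 * a := by positivity
  have h1 : HasDerivAt (fun t : ℝ => 1 + t ^ 2 * a) (2 * t * a) t := by
    simpa using ((hasDerivAt_pow 2 t).mul_const a).const_add 1
  have h2 := (h1.sqrt hpos.ne').inv (Real.sqrt_pos.2 hpos).ne'
  refine h2.congr_deriv ?_
  have := Real.sqrt_pos.2 hpos
  field_simp

theorem hasDerivAt_inv_sqrt_deriv (a : ℝ) (ha : 0 ≤ a) :
    HasDerivAt (fun t : ℝ => -(t * a) * (√(1 + t ^ 2 * a))⁻¹ ^ 3) (-a) 0 := by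
  have h1 : HasDerivAt (fun t : ℝ => -(t * a)) (-a) 0 := by
    exact (((hasDerivAt_id (0 : ℝ)).mul_const a).neg).congr_deriv (by simp)
  exact (h1.mul ((hasDerivAt_inv_sqrt a 0 ha).pow 3)).congr_deriv (by simp)

/-- The differential of the radial graph. -/
theorem fderiv_radialGraph {z : Sph n → ℝ} (hz : ContMDiff (𝓡 n) 𝓘(ℝ, ℝ) 2 z)
    (hξ : inner ℝ (u : Euc n) ξ = 0) :
    fderiv ℝ (radialGraph z) u ξ
        = fderiv ℝ (fun y => z (sphProj y)) u ξ • (u : Euc n) + z u • ξ ∧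
      fderiv ℝ (fderiv ℝ (radialGraph z)) u ξ ξ
        = (fderiv ℝ (fderiv ℝ fun y => z (sphProj y)) u ξ ξ - z u * ‖ξ‖ ^ 2) • (u : Euc n)
          + (2 * fderiv ℝ (fun y => z (sphProj y)) u ξ) • ξ := by
  have hu : (u : Euc n) ≠ 0 := ne_zero_of_mem_unit_sphere u
  have hZ := hz.contDiffAt_comp_sphProj hu
  have hr : ContDiffAt ℝ 2 (radialGraph z) u := by
    have : radialGraph z = fun x => z (sphProj x) • (‖x‖⁻¹ • x) := funext (radialGraph_eq z)
    rw [this]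
    exact hZ.smul (((contDiffAt_norm ℝ hu).inv (norm_ne_zero_iff.2 hu)).smul contDiffAt_id)
  obtain ⟨hr1, hr2⟩ := hr.hasDerivAt_line ξ
  obtain ⟨hZ1, hZ2⟩ := hZ.hasDerivAt_line ξ
  set ζ := fun t : ℝ => z (sphProj ((u : Euc n) + t • ξ))
  set ζ' := fun t : ℝ => fderiv ℝ (fun y => z (sphProj y)) ((u : Euc n) + t • ξ) ξ
  set a := ‖ξ‖ ^ 2
  have ha : 0 ≤ a := sq_nonneg _
  set c := fun t : ℝ => (√(1 + t ^ 2 * a))⁻¹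
  set c' := fun t : ℝ => -(t * a) * (√(1 + t ^ 2 * a))⁻¹ ^ 3
  have hc : ∀ t, HasDerivAt c (c' t) t := fun t => hasDerivAt_inv_sqrt a t ha
  have hc' : HasDerivAt c' (-a) 0 := hasDerivAt_inv_sqrt_deriv a ha
  -- The normalizing factor satisfies `c 0 = 1`, `c' 0 = 0` and has second derivative `-‖ξ‖ ^ 2` at
  -- `0`; the latter produces the term `-z u * ‖ξ‖ ^ 2`.
  have hrc : (fun t : ℝ => radialGraph z ((u : Euc n) + t • ξ))
      = fun t => (ζ t * c t) • ((u : Euc n) + t • ξ) := by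
    funext t
    rw [radialGraph_eq, norm_add_smul_eq_sqrt hξ, smul_smul]
  have hline : ∀ t : ℝ, HasDerivAt (fun t : ℝ => (u : Euc n) + t • ξ) ξ t := fun t => by
    simpa using ((hasDerivAt_id t).smul_const ξ).const_add (u : Euc n)
  have hd1 : ∀ᶠ t in 𝓝 (0 : ℝ), fderiv ℝ (radialGraph z) ((u : Euc n) + t • ξ) ξ =
      (ζ t * c t) • ξ + (ζ' t * c t + ζ t * c' t) • ((u : Euc n) + t • ξ) := by
    filter_upwards [hr1, hZ1] with t h1 h2
    rw [hrc] at h1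
    exact h1.unique ((h2.mul (hc t)).smul (hline t))
  have e0 : ζ 0 = z u := by simp [ζ, sphProj_coe]
  have e1 : c 0 = 1 := by simp [c]
  have e2 : c' 0 = 0 := by simp [c']
  have hζ0 : HasDerivAt ζ (ζ' 0) 0 := hZ1.self_of_nhds
  constructor
  · have := hd1.self_of_nhds
    simp only [e0, e1, e2, zero_smul, add_zero, mul_one, mul_zero] at this
    rw [this, add_comm]
    simp [ζ']
  · have h3 := ((hζ0.mul (hc 0)).smul_const ξ).add
      (((hZ2.mul (hc 0)).add (hζ0.mul hc')).smul (hline 0))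
    have h4 := hr2.unique (h3.congr_of_eventuallyEq hd1)
    rw [h4]
    simp only [e0, e1, e2, zero_smul, add_zero, mul_one, mul_zero, zero_add, Pi.add_apply,
      Pi.mul_apply]
    have : ζ' 0 = fderiv ℝ (fun y => z (sphProj y)) u ξ := by simp [ζ']
    rw [this]
    module

/-- Comparison of derivatives at a point where `σ (z - R)` is touched from below by an exponential
barrier. -/
theorem deriv_of_isLocalMin_sub_exp {z : Sph n → ℝ} (hz : ContMDiff (𝓡 n) 𝓘(ℝ, ℝ) 2 z)
    (hξ : inner ℝ (u : Euc n) ξ = 0) {σ R ε α : ℝ} {p : Euc n}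
    (hmin : IsLocalMin (fun v : Sph n =>
      σ * (z v - R) - ε * Real.exp (α * inner ℝ (v : Euc n) p)) u) :
    σ * fderiv ℝ (fun y => z (sphProj y)) u ξ
        = ε * α * Real.exp (α * inner ℝ (u : Euc n) p) * inner ℝ ξ p ∧
      ε * α * Real.exp (α * inner ℝ (u : Euc n) p) *
        (α * inner ℝ ξ p ^ 2 - inner ℝ (u : Euc n) p * ‖ξ‖ ^ 2)
        ≤ σ * fderiv ℝ (fderiv ℝ fun y => z (sphProj y)) u ξ ξ := by
  have hu : (u : Euc n) ≠ 0 := ne_zero_of_mem_unit_sphere u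
  have hZ := hz.contDiffAt_comp_sphProj hu
  obtain ⟨hZ1, hZ2⟩ := hZ.hasDerivAt_line ξ
  set ζ := fun t : ℝ => z (sphProj ((u : Euc n) + t • ξ))
  set ζ' := fun t : ℝ => fderiv ℝ (fun y => z (sphProj y)) ((u : Euc n) + t • ξ) ξ with hζ'
  set a := ‖ξ‖ ^ 2
  have ha : 0 ≤ a := sq_nonneg _
  set c := fun t : ℝ => (√(1 + t ^ 2 * a))⁻¹
  set c' := fun t : ℝ => -(t * a) * (√(1 + t ^ 2 * a))⁻¹ ^ 3
  have hc : ∀ t, HasDerivAt c (c' t) t := fun t => hasDerivAt_inv_sqrt a t ha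
  have hc' : HasDerivAt c' (-a) 0 := hasDerivAt_inv_sqrt_deriv a ha
  set s := inner ℝ (u : Euc n) p
  set q := inner ℝ ξ p
  set θ := fun t : ℝ => (s + t * q) * c t
  set θ' := fun t : ℝ => q * c t + (s + t * q) * c' t
  have hlin : ∀ t : ℝ, HasDerivAt (fun t : ℝ => s + t * q) q t := fun t => by
    simpa using ((hasDerivAt_id t).mul_const q).const_add s
  have hθ : ∀ t, HasDerivAt θ (θ' t) t := fun t => (hlin t).mul (hc t)
  have e1 : c 0 = 1 := by simp [c]
  have e2 : c' 0 = 0 := by simp [c']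
  have hθ' : HasDerivAt θ' (-(s * a)) 0 := by
    refine (((hc 0).const_mul q).add ((hlin 0).mul hc')).congr_deriv ?_
    rw [e2]; ring
  have hex : ∀ t, HasDerivAt (fun t => Real.exp (α * θ t)) (Real.exp (α * θ t) * (α * θ' t)) t :=
    fun t => ((hθ t).const_mul α).exp
  have hex' := (hex 0).mul (hθ'.const_mul α)
  have hproj : Tendsto (fun t : ℝ => sphProj ((u : Euc n) + t • ξ)) (𝓝 0) (𝓝 u) := by
    have h1 : ContinuousAt (sphProj : Euc n → Sph n) ((u : Euc n) + (0 : ℝ) • ξ) := by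
      rw [zero_smul, add_zero]
      exact (contMDiffAt_sphProj hu).continuousAt
    have h2 : ContinuousAt (fun t : ℝ => (u : Euc n) + t • ξ) 0 := by fun_prop
    have h3 : ContinuousAt (fun t : ℝ => sphProj ((u : Euc n) + t • ξ)) 0 :=
      ContinuousAt.comp (f := fun t : ℝ => (u : Euc n) + t • ξ) h1 h2
    simpa [ContinuousAt, sphProj_coe] using h3
  -- Pull the minimum on the sphere back to the projected line; `θ` is the inner product of the
  -- projected point with `p`, with `θ'' (0) = -s * ‖ξ‖ ^ 2`.
  have hmin' : IsLocalMin (fun t : ℝ => σ * (ζ t - R) - ε * Real.exp (α * θ t)) 0 := by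
    have := hproj.eventually hmin
    filter_upwards [this] with t ht
    have hne : (u : Euc n) + t • ξ ≠ 0 := by
      rw [← norm_ne_zero_iff, norm_add_smul_eq_sqrt hξ]
      positivity
    have h1 : inner ℝ (sphProj ((u : Euc n) + t • ξ) : Euc n) p = θ t := by
      rw [coe_sphProj hne, real_inner_smul_left, inner_add_left, real_inner_smul_left,
        norm_add_smul_eq_sqrt hξ, mul_comm]
    have h2 : θ 0 = s := by simp [θ, e1]
    have h3 : ζ 0 = z u := by simp [ζ, sphProj_coe]
    simp only [h1] at ht
    simpa only [h2, h3] using ht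
  have hF : ∀ᶠ t in 𝓝 (0 : ℝ), HasDerivAt (fun t : ℝ => σ * (ζ t - R) - ε * Real.exp (α * θ t))
      (σ * ζ' t - ε * (Real.exp (α * θ t) * (α * θ' t))) t := by
    filter_upwards [hZ1] with t ht
    exact ((ht.sub_const R).const_mul σ).sub ((hex t).const_mul ε)
  have hF' := (hZ2.const_mul σ).sub (hex'.const_mul ε)
  obtain ⟨h1, h2⟩ := hmin'.nonneg_of_hasDerivAt hF hF'
  have h3 : θ 0 = s := by simp [θ, e1]
  have h4 : θ' 0 = q := by simp [θ', e1, e2]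
  have h5 : ζ' 0 = fderiv ℝ (fun y => z (sphProj y)) u ξ := by simp [ζ']
  rw [h3, h4] at h1 h2
  rw [← h5]
  exact ⟨by linear_combination h1, by linear_combination h2⟩

end Line

/-! ### The warping function and the curvature of geodesic spheres -/

theorem SpaceForm.pos_of_mem_radii {K : SpaceForm} {ρ : ℝ} (hρ : ρ ∈ K.radii) :
    0 < ρ ∧ 0 < K.warp ρ ∧ 0 < K.cotan ρ := by
  cases K with
  | hyperbolic =>
    have h : (0 : ℝ) < ρ := hρ
    have := Real.sinh_pos_iff.2 h
    exact ⟨h, pow_pos this 2, div_pos (Real.cosh_pos ρ) this⟩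
  | elliptic =>
    obtain ⟨h1, h2⟩ : 0 < ρ ∧ ρ < Real.pi / 2 := hρ
    have h3 := Real.sin_pos_of_pos_of_lt_pi h1 (by linarith)
    exact ⟨h1, pow_pos h3 2, div_pos (Real.cos_pos_of_mem_Ioo ⟨by linarith, h2⟩) h3⟩

/-- In other words `κ = f' / (2 f)`, the principal curvature of the geodesic sphere of radius `ρ`.
-/
theorem SpaceForm.hasDerivAt_warp {K : SpaceForm} {ρ : ℝ} (hρ : ρ ∈ K.radii) :
    HasDerivAt K.warp (2 * K.cotan ρ * K.warp ρ) ρ := by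
  have hw := (K.pos_of_mem_radii hρ).2.1
  cases K with
  | hyperbolic =>
    have h : Real.sinh ρ ≠ 0 := fun h => by simp [warp, h] at hw
    refine ((Real.hasDerivAt_sinh ρ).pow 2).congr_deriv ?_
    simp only [cotan, warp]; field_simp; norm_num
  | elliptic =>
    have h : Real.sin ρ ≠ 0 := fun h => by simp [warp, h] at hw
    refine ((Real.hasDerivAt_sin ρ).pow 2).congr_deriv ?_
    simp only [cotan, warp]; field_simp; norm_num; ring

/-- After clearing denominators the difference is `sinh (ρ' - ρ)`, respectively `sin (ρ' - ρ)`. -/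
theorem SpaceForm.cotan_anti {K : SpaceForm} {ρ ρ' : ℝ} (hρ : ρ ∈ K.radii) (hρ' : ρ' ∈ K.radii)
    (h : ρ ≤ ρ') : K.cotan ρ' ≤ K.cotan ρ := by
  cases K with
  | hyperbolic =>
    have h1 : (0 : ℝ) < ρ := hρ
    have h2 : (0 : ℝ) < ρ' := hρ'
    simp only [cotan]
    rw [div_le_div_iff₀ (Real.sinh_pos_iff.2 h2) (Real.sinh_pos_iff.2 h1)]
    have := Real.sinh_nonneg_iff.2 (sub_nonneg.2 h)
    rw [Real.sinh_sub] at this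
    linarith
  | elliptic =>
    obtain ⟨h1, h2⟩ : 0 < ρ ∧ ρ < Real.pi / 2 := hρ
    obtain ⟨h3, h4⟩ : 0 < ρ' ∧ ρ' < Real.pi / 2 := hρ'
    simp only [cotan]
    rw [div_le_div_iff₀ (Real.sin_pos_of_pos_of_lt_pi h3 (by linarith))
      (Real.sin_pos_of_pos_of_lt_pi h1 (by linarith))]
    have := Real.sin_nonneg_of_nonneg_of_le_pi (sub_nonneg.2 h) (by linarith)
    rw [Real.sin_sub] at this
    linarith

theorem SpaceForm.Icc_subset_radii {K : SpaceForm} {R₁ R₂ : ℝ} (h₁ : R₁ ∈ K.radii)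
    (h₂ : R₂ ∈ K.radii) : Set.Icc R₁ R₂ ⊆ K.radii := by
  cases K with
  | hyperbolic => exact fun x hx => lt_of_lt_of_le (show 0 < R₁ from h₁) hx.1
  | elliptic =>
    exact fun x hx => ⟨lt_of_lt_of_le (show 0 < R₁ from h₁.1) hx.1,
      lt_of_le_of_lt hx.2 (show R₂ < Real.pi / 2 from h₂.2)⟩

/-! ### The metric and its Christoffel symbols in Cartesian coordinates -/

section Metric

variable {n : ℕ} (K : SpaceForm)

/-- The metric at `p` as a bilinear map. -/
def SpaceForm.metricBilin (p : Euc n) : Euc n →ₗ[ℝ] Euc n →ₗ[ℝ] ℝ :=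
  LinearMap.mk₂ ℝ (K.metric p)
    (fun v v' w => by simp only [metric, inner_add_left]; ring)
    (fun c v w => by simp only [metric, real_inner_smul_left, smul_eq_mul]; ring)
    (fun v w w' => by simp only [metric, inner_add_left, inner_add_right]; ring)
    (fun c v w => by
      simp only [metric, real_inner_smul_left, real_inner_smul_right, smul_eq_mul]; ring)

theorem SpaceForm.metricBilin_apply (p v w : Euc n) : K.metricBilin p v w = K.metric p v w := rfl

variable {K} {u : Sph n} {ρ : ℝ}

theorem SpaceForm.metric_smul_coe (hρ : 0 < ρ) (v w : Euc n) :
    K.metric (ρ • (u : Euc n)) v w = inner ℝ v u * inner ℝ w u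
      + K.warp ρ * ((inner ℝ v w - inner ℝ v u * inner ℝ w u) / ρ ^ 2) := by
  have hn : ‖ρ • (u : Euc n)‖ = ρ := by simp [norm_smul, abs_of_pos hρ]
  have hu : ρ⁻¹ • ρ • (u : Euc n) = u := inv_smul_smul₀ hρ.ne' _
  simp only [metric, hn, hu]

/-- The directional derivative of the components of the metric. -/
theorem SpaceForm.fderiv_metric (hρ : ρ ∈ K.radii) (v w y : Euc n) :
    fderiv ℝ (fun q => K.metric q v w) (ρ • (u : Euc n)) y =
      (1 - K.warp ρ / ρ ^ 2) *
        ((inner ℝ v y - inner ℝ v u * inner ℝ (u : Euc n) y) * inner ℝ w u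
          + inner ℝ v u * (inner ℝ w y - inner ℝ w u * inner ℝ (u : Euc n) y)) / ρ
      + (inner ℝ v w - inner ℝ v u * inner ℝ w u) * inner ℝ (u : Euc n) y *
        (2 * K.cotan ρ * K.warp ρ / ρ ^ 2 - 2 * K.warp ρ / ρ ^ 3) := by
  have hρ0 := (K.pos_of_mem_radii hρ).1
  obtain ⟨p, hp⟩ : ∃ p, p = ρ • (u : Euc n) := ⟨_, rfl⟩
  rw [← hp]
  have hn : ‖p‖ = ρ := by simp [hp, norm_smul, abs_of_pos hρ0]
  have hp0 : p ≠ 0 := norm_ne_zero_iff.1 (by rw [hn]; exact hρ0.ne')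
  have hW : HasDerivAt K.warp (2 * K.cotan ρ * K.warp ρ) ‖p‖ := by
    rw [hn]; exact K.hasDerivAt_warp hρ
  have hdiff : DifferentiableAt ℝ (fun q => K.metric q v w) p := by
    have hN : DifferentiableAt ℝ (fun q : Euc n => ‖q‖) p := differentiableAt_id.norm ℝ hp0
    have hNi : DifferentiableAt ℝ (fun q : Euc n => ‖q‖⁻¹) p := hN.inv (norm_ne_zero_iff.2 hp0)
    have hWN : DifferentiableAt ℝ (fun q : Euc n => K.warp ‖q‖) p :=
      hW.differentiableAt.comp p hN
    have hu : DifferentiableAt ℝ (fun q : Euc n => ‖q‖⁻¹ • q) p := hNi.smul differentiableAt_id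
    have h1 : ∀ v : Euc n, DifferentiableAt ℝ (fun q : Euc n => inner ℝ v (‖q‖⁻¹ • q)) p :=
      fun v => (differentiableAt_const v).inner ℝ hu
    simp only [metric, div_eq_mul_inv, ← inv_pow]
    exact ((h1 v).mul (h1 w)).add (hWN.mul (((differentiableAt_const _).sub
      ((h1 v).mul (h1 w))).mul (hNi.pow 2)))
  have hline : HasDerivAt (fun t : ℝ => p + t • y) y 0 := by
    simpa using ((hasDerivAt_id (0 : ℝ)).smul_const y).const_add p
  have hp00 : p + (0 : ℝ) • y = p := by simp
  have hd : HasDerivAt (fun t : ℝ => K.metric (p + t • y) v w)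
      (fderiv ℝ (fun q => K.metric q v w) p y) 0 := by
    have h1 := hdiff.hasFDerivAt
    rw [← hp00] at h1
    have h2 := h1.comp_hasDerivAt (0 : ℝ) hline
    rwa [hp00] at h2
  have hN : HasDerivAt (fun t : ℝ => ‖p + t • y‖) (inner ℝ (u : Euc n) y) 0 := by
    have h1 := hline.norm_sq.sqrt (by simp [hp0])
    simp only [Real.sqrt_sq (norm_nonneg _)] at h1
    refine h1.congr_deriv ?_
    rw [hp00, hn, hp, real_inner_smul_left]
    field_simp
  have hNi : HasDerivAt (fun t : ℝ => ‖p + t • y‖⁻¹) (-inner ℝ (u : Euc n) y / ρ ^ 2) 0 := by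
    have h1 := hN.inv (by rw [hp00, hn]; exact hρ0.ne')
    rw [hp00, hn] at h1
    exact h1
  have hWN : HasDerivAt (fun t : ℝ => K.warp ‖p + t • y‖)
      (2 * K.cotan ρ * K.warp ρ * inner ℝ (u : Euc n) y) 0 := by
    rw [← hp00] at hW
    exact hW.comp (0 : ℝ) hN
  have hA : ∀ v : Euc n, HasDerivAt (fun t : ℝ => ‖p + t • y‖⁻¹ * inner ℝ v (p + t • y))
      ((inner ℝ v y - inner ℝ v u * inner ℝ (u : Euc n) y) / ρ) 0 := by
    intro v
    have h1 : HasDerivAt (fun t : ℝ => inner ℝ v (p + t • y)) (inner ℝ v y) 0 := by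
      simpa using (hasDerivAt_const (0 : ℝ) v).inner ℝ hline
    refine (hNi.mul h1).congr_deriv ?_
    simp only [hp00, hn]
    rw [hp, real_inner_smul_right]
    field_simp
    ring
  -- The product rule for the shape of the metric, with `A`, `B` the radial components, `I` the
  -- inverse norm and `W` the warping factor.
  have key : ∀ (A B I W : ℝ → ℝ) (c A' B' I' W' : ℝ), HasDerivAt A A' 0 → HasDerivAt B B' 0 →
      HasDerivAt I I' 0 → HasDerivAt W W' 0 →
      HasDerivAt (fun t => A t * B t + W t * ((c - A t * B t) * I t ^ 2))
        (A' * B 0 + A 0 * B' + (W' * ((c - A 0 * B 0) * I 0 ^ 2)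
          + W 0 * (-(A' * B 0 + A 0 * B') * I 0 ^ 2 + (c - A 0 * B 0) * (2 * I 0 * I')))) 0 := by
    intro A B I W c A' B' I' W' hA hB hI hW
    refine ((hA.mul hB).add (hW.mul (((hA.mul hB).const_sub c).mul (hI.pow 2)))).congr_deriv ?_
    simp [Pi.mul_apply, Pi.pow_apply]
  have hm := key _ _ _ _ (inner ℝ v w) _ _ _ _ (hA v) (hA w) hNi hWN
  have heq : ∀ t : ℝ, K.metric (p + t • y) v w =
      (‖p + t • y‖⁻¹ * inner ℝ v (p + t • y)) * (‖p + t • y‖⁻¹ * inner ℝ w (p + t • y))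
        + K.warp ‖p + t • y‖ * ((inner ℝ v w - (‖p + t • y‖⁻¹ * inner ℝ v (p + t • y)) *
          (‖p + t • y‖⁻¹ * inner ℝ w (p + t • y))) * ‖p + t • y‖⁻¹ ^ 2) := by
    intro t
    simp only [metric, real_inner_smul_right, div_eq_mul_inv, inv_pow]
  simp only [heq] at hd
  rw [hd.unique hm]
  simp only [hp00, hn]
  rw [hp, real_inner_smul_right, real_inner_smul_right]
  field_simp
  ring

theorem SpaceForm.christoffel_smul_coe (hρ : ρ ∈ K.radii) (v w y : Euc n) :
    K.christoffel (ρ • (u : Euc n)) v w y =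
      (1 - K.warp ρ / ρ ^ 2) * (inner ℝ v w - inner ℝ v u * inner ℝ w u) * inner ℝ y u / ρ
      + (inner ℝ w y * inner ℝ v u + inner ℝ v y * inner ℝ w u - inner ℝ v w * inner ℝ y u
          - inner ℝ v u * inner ℝ w u * inner ℝ y u) *
        (K.cotan ρ * K.warp ρ / ρ ^ 2 - K.warp ρ / ρ ^ 3) := by
  have hρ0 := (K.pos_of_mem_radii hρ).1
  rw [christoffel, K.fderiv_metric hρ, K.fderiv_metric hρ, K.fderiv_metric hρ]
  simp only [real_inner_comm (u : Euc n), real_inner_comm w v, real_inner_comm w y,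
    real_inner_comm v y]
  field_simp
  ring

end Metric

/-! ### Fundamental forms and the unit normal of a radial graph -/

section Forms

variable {n : ℕ} {K : SpaceForm} {z : Sph n → ℝ} {u : Sph n}

theorem inner_coe_self (u : Sph n) : inner ℝ (u : Euc n) (u : Euc n) = (1 : ℝ) := by
  simp

/-- The first fundamental form as a bilinear map. -/
def firstFormBilin (K : SpaceForm) (z : Sph n → ℝ) (u : Sph n) : Euc n →ₗ[ℝ] Euc n →ₗ[ℝ] ℝ :=
  (K.metricBilin (z u • (u : Euc n))).compl₁₂
    (fderiv ℝ (radialGraph z) u : Euc n →ₗ[ℝ] Euc n) (fderiv ℝ (radialGraph z) u : Euc n →ₗ[ℝ] Euc n)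

theorem firstFormBilin_apply (ξ η : Euc n) : firstFormBilin K z u ξ η = firstForm K z u ξ η := rfl

/-- The second fundamental form is bilinear. -/
theorem exists_secondFormBilin (hz : z u ∈ K.radii) (N : Euc n) :
    ∃ S : Euc n →ₗ[ℝ] Euc n →ₗ[ℝ] ℝ, ∀ ξ η, S ξ η = secondForm K z u N ξ η := by
  refine ⟨LinearMap.mk₂ ℝ (secondForm K z u N) ?_ ?_ ?_ ?_, fun _ _ => rfl⟩
  · intro v v' w
    simp only [secondForm, K.christoffel_smul_coe hz, map_add, ← K.metricBilin_apply,
      LinearMap.add_apply, inner_add_left, add_apply]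
    ring
  · intro c v w
    simp only [secondForm, K.christoffel_smul_coe hz, map_smul, ← K.metricBilin_apply,
      LinearMap.smul_apply, real_inner_smul_left, smul_apply, smul_eq_mul]
    ring
  · intro v w w'
    simp only [secondForm, K.christoffel_smul_coe hz, map_add, ← K.metricBilin_apply,
      LinearMap.add_apply, inner_add_left, inner_add_right]
    ring
  · intro c v w
    simp only [secondForm, K.christoffel_smul_coe hz, map_smul, ← K.metricBilin_apply,
      LinearMap.smul_apply, real_inner_smul_left, real_inner_smul_right,
      smul_eq_mul]
    ring

theorem inner_coe_right {ξ : Euc n} (hξ : inner ℝ (u : Euc n) ξ = 0) :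
    inner ℝ ξ (u : Euc n) = (0 : ℝ) := by rwa [real_inner_comm]

/-- The differential of the graph has radial part `dz ξ` and spherical part `z ξ`, and `h` splits
orthogonally along these. -/
theorem firstForm_eq (hzs : ContMDiff (𝓡 n) 𝓘(ℝ, ℝ) 2 z) 
    (hz : z u ∈ K.radii) {ξ η : Euc n} (hξ : inner ℝ (u : Euc n) ξ = 0)
    (hη : inner ℝ (u : Euc n) η = 0) :
    firstForm K z u ξ η = fderiv ℝ (fun y => z (sphProj y)) u ξ *
      fderiv ℝ (fun y => z (sphProj y)) u η + K.warp (z u) * inner ℝ ξ η := by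
  have hz0 := (K.pos_of_mem_radii hz).1
  rw [firstForm, K.metric_smul_coe hz0, (fderiv_radialGraph hzs hξ).1,
    (fderiv_radialGraph hzs hη).1]
  simp only [inner_add_left, inner_add_right, real_inner_smul_left, real_inner_smul_right,
    inner_coe_self, hη, inner_coe_right hη, inner_coe_right hξ]
  field_simp
  ring

/-- Orthogonality to the graph determines the tangential part of `N` from its radial component. -/
theorem IsInnerUnitNormal.inner_eq (hzs : ContMDiff (𝓡 n) 𝓘(ℝ, ℝ) 2 z) 
    (hz : z u ∈ K.radii) {N : Euc n}
    (hN : IsInnerUnitNormal K z u N) {ξ : Euc n} (hξ : inner ℝ (u : Euc n) ξ = 0) :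
    K.warp (z u) * inner ℝ ξ N
      = -(inner ℝ N u * fderiv ℝ (fun y => z (sphProj y)) u ξ * z u) := by
  have hz0 := (K.pos_of_mem_radii hz).1
  have h := hN.normal ξ hξ
  rw [K.metric_smul_coe hz0, (fderiv_radialGraph hzs hξ).1] at h
  simp only [inner_add_left, real_inner_smul_left, inner_coe_self, inner_coe_right hξ,
    real_inner_comm N (u : Euc n)] at h
  have h1 : z u * (K.warp (z u) * inner ℝ ξ N
      + inner ℝ N u * fderiv ℝ (fun y => z (sphProj y)) u ξ * z u) = 0 := by
    field_simp at h
    linear_combination h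
  linear_combination (mul_eq_zero.1 h1).resolve_left hz0.ne'

theorem IsInnerUnitNormal.inner_neg (hz : z u ∈ K.radii) {N : Euc n}
    (hN : IsInnerUnitNormal K z u N) : inner ℝ N u < (0 : ℝ) := by
  have h := hN.inward
  rw [K.metric_smul_coe (K.pos_of_mem_radii hz).1, inner_coe_self] at h
  simpa using h

theorem IsInnerUnitNormal.unit_eq (hz : z u ∈ K.radii) {N : Euc n}
    (hN : IsInnerUnitNormal K z u N) :
    inner ℝ N u ^ 2 + K.warp (z u) * (inner ℝ N N - inner ℝ N u ^ 2) / z u ^ 2 = (1 : ℝ) := by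
  have h := hN.unit
  rw [K.metric_smul_coe (K.pos_of_mem_radii hz).1] at h
  linear_combination h

/-- Orthogonality makes `N` and `N'` proportional, unit length fixes the factor up to sign, and
pointing inward fixes the sign. -/
theorem IsInnerUnitNormal.unique (hzs : ContMDiff (𝓡 n) 𝓘(ℝ, ℝ) 2 z) 
    (hz : z u ∈ K.radii) {N N' : Euc n}
    (hN : IsInnerUnitNormal K z u N) (hN' : IsInnerUnitNormal K z u N') : N = N' := by
  obtain ⟨hz0, hW, -⟩ := K.pos_of_mem_radii hz
  set a := inner ℝ N (u : Euc n) with ha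
  set a' := inner ℝ N' (u : Euc n) with ha'
  have han : a < 0 := hN.inner_neg hz
  have han' : a' < 0 := hN'.inner_neg hz
  have h0 : a' • N = a • N' := by
    set M := a' • N - a • N' with hM
    have hMu : inner ℝ (u : Euc n) M = 0 := by
      rw [hM, inner_sub_right, real_inner_smul_right, real_inner_smul_right,
        real_inner_comm, real_inner_comm N', ← ha, ← ha']
      ring
    have h1 := hN.inner_eq hzs hz hMu
    have h2 := hN'.inner_eq hzs hz hMu
    rw [← ha] at h1
    rw [← ha'] at h2
    have h3 : K.warp (z u) * inner ℝ M M = 0 := by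
      have : inner ℝ M M = a' * inner ℝ M N - a * inner ℝ M N' := by
        conv_lhs => rw [hM, inner_sub_right, real_inner_smul_right, real_inner_smul_right, ← hM]
      rw [this]
      linear_combination a' * h1 - a * h2
    have h4 : M = 0 := inner_self_eq_zero.1 ((mul_eq_zero.1 h3).resolve_left hW.ne')
    exact sub_eq_zero.1 h4
  have h1 := hN.unit_eq hz
  have h2 := hN'.unit_eq hz
  rw [← ha] at h1
  rw [← ha'] at h2
  have h3 : a' ^ 2 * inner ℝ N N = a ^ 2 * inner ℝ N' N' := by
    have := congrArg (fun v => inner ℝ v v) h0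
    simp only [real_inner_smul_left, real_inner_smul_right] at this
    linear_combination this
  have h4 : a' ^ 2 = a ^ 2 := by
    linear_combination a ^ 2 * h2 - a' ^ 2 * h1 + K.warp (z u) / z u ^ 2 * h3
  have h5 : a' = a := by nlinarith
  rw [h5] at h0
  exact smul_right_injective _ han.ne h0

/-- The second fundamental form on the diagonal. -/
theorem secondForm_self_eq (hzs : ContMDiff (𝓡 n) 𝓘(ℝ, ℝ) 2 z) 
    (hz : z u ∈ K.radii) {N : Euc n}
    (hN : IsInnerUnitNormal K z u N) {ξ : Euc n} (hξ : inner ℝ (u : Euc n) ξ = 0) :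
    secondForm K z u N ξ ξ = -inner ℝ N u *
      (K.cotan (z u) * (firstForm K z u ξ ξ + fderiv ℝ (fun y => z (sphProj y)) u ξ ^ 2)
        - fderiv ℝ (fderiv ℝ fun y => z (sphProj y)) u ξ ξ) := by
  obtain ⟨hz0, hW, -⟩ := K.pos_of_mem_radii hz
  have h1 := hN.inner_eq hzs hz hξ
  rw [firstForm_eq hzs hz hξ hξ, secondForm, K.metric_smul_coe hz0, K.christoffel_smul_coe hz,
    (fderiv_radialGraph hzs hξ).1, (fderiv_radialGraph hzs hξ).2]
  simp only [inner_add_left, inner_add_right, real_inner_smul_left, real_inner_smul_right,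
    inner_coe_self, hξ, inner_coe_right hξ, real_inner_comm N (u : Euc n),
    ← real_inner_self_eq_norm_sq]
  have h2 : inner ℝ ξ N = -(inner ℝ N u * fderiv ℝ (fun y => z (sphProj y)) u ξ * z u)
      / K.warp (z u) := by
    rw [eq_div_iff hW.ne', ← h1, mul_comm]
  rw [h2]
  field_simp
  ring

/-- Bounds for the radial component of the unit normal in terms of the gradient. -/
theorem IsInnerUnitNormal.inner_bounds (hzs : ContMDiff (𝓡 n) 𝓘(ℝ, ℝ) 2 z) 
    (hz : z u ∈ K.radii) {N : Euc n}
    (hN : IsInnerUnitNormal K z u N) {g : ℝ}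
    (hg : ∀ ξ, inner ℝ (u : Euc n) ξ = 0 → |fderiv ℝ (fun y => z (sphProj y)) u ξ| ≤ g * ‖ξ‖) :
    0 < -inner ℝ N (u : Euc n) ∧ -inner ℝ N (u : Euc n) ≤ 1 ∧
      1 - g ^ 2 / K.warp (z u) ≤ -inner ℝ N (u : Euc n) := by
  obtain ⟨hz0, hW, -⟩ := K.pos_of_mem_radii hz
  set a := inner ℝ N (u : Euc n) with ha
  have han : a < 0 := hN.inner_neg hz
  have hunit := hN.unit_eq hz
  rw [← ha] at hunit
  set τ := N - a • (u : Euc n) with hτ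
  have hτu : inner ℝ (u : Euc n) τ = 0 := by
    rw [hτ, inner_sub_right, real_inner_smul_right, inner_coe_self, real_inner_comm, ← ha]; ring
  have hτN : inner ℝ τ N = ‖τ‖ ^ 2 := by
    rw [← real_inner_self_eq_norm_sq]
    conv_rhs => rw [hτ, inner_sub_right, ← hτ, real_inner_smul_right, inner_coe_right hτu]
    ring
  have hNN : inner ℝ N N - a ^ 2 = ‖τ‖ ^ 2 := by
    rw [← hτN, hτ, inner_sub_left, real_inner_smul_left, real_inner_comm N (u : Euc n), ← ha]
    ring
  rw [hNN] at hunit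
  have h1 := hN.inner_eq hzs hz hτu
  rw [hτN, ← ha] at h1
  have h2 := hg τ hτu
  have hle : a ^ 2 ≤ 1 := by
    have : 0 ≤ K.warp (z u) * ‖τ‖ ^ 2 / z u ^ 2 := by positivity
    linarith
  have h3 : K.warp (z u) * ‖τ‖ ^ 2 ≤ -a * z u * g * ‖τ‖ := by
    rw [h1]
    have h4 := (le_abs_self _).trans h2
    have : 0 ≤ -a * z u := by nlinarith
    nlinarith
  have h4 : (K.warp (z u) * ‖τ‖) ^ 2 ≤ (-a * z u * g) ^ 2 := by
    rcases (norm_nonneg τ).eq_or_lt with h | h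
    · rw [← h]; simp; positivity
    · have : K.warp (z u) * ‖τ‖ ≤ -a * z u * g := by
        refine le_of_mul_le_mul_right ?_ h
        linarith
      gcongr
  have h5 : 1 ≤ a ^ 2 * (1 + g ^ 2 / K.warp (z u)) := by
    have : K.warp (z u) * ‖τ‖ ^ 2 / z u ^ 2 ≤ a ^ 2 * (g ^ 2 / K.warp (z u)) := by
      rw [div_le_iff₀ (by positivity), ← mul_div_assoc, div_mul_eq_mul_div, le_div_iff₀ hW]
      linarith
    linarith
  have h6 : 0 ≤ g ^ 2 / K.warp (z u) := by positivity
  refine ⟨by linarith, by nlinarith, ?_⟩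
  -- Since `0 < -a ≤ 1`, `h5` gives `1 ≤ a ^ 2 * (1 + x) ≤ -a * (1 + x) ≤ -a + x`.
  set x := g ^ 2 / K.warp (z u)
  nlinarith

end Forms

/-! ### Independence of the choice of orthonormal frame -/

section Frames

variable {n : ℕ} {u : Sph n} {B S : Euc n →ₗ[ℝ] Euc n →ₗ[ℝ] ℝ} {e e' : Fin n → Euc n}

/-- The expansion of a tangent vector in an orthonormal frame. -/
theorem eq_sum_of_orthonormal (he : ∀ i, inner ℝ (u : Euc n) (e i) = 0)
    (hB : ∀ i j, B (e i) (e j) = if i = j then 1 else 0) {τ : Euc n}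
    (hτ : inner ℝ (u : Euc n) τ = 0) : τ = ∑ j, B τ (e j) • e j := by
  have hcoef : ∀ (c : Fin n → ℝ) i, B (∑ j, c j • e j) (e i) = c i := by
    intro c i
    simp [hB]
  have hli : LinearIndependent ℝ e := by
    rw [Fintype.linearIndependent_iff]
    intro c hc i
    rw [← hcoef c i, hc]; simp
  have hfact : Fact (Module.finrank ℝ (Euc n) = n + 1) := ⟨finrank_euclideanSpace_fin⟩
  have hfin : Module.finrank ℝ (ℝ ∙ (u : Euc n))ᗮ = n :=
    Submodule.finrank_orthogonal_span_singleton (ne_zero_of_mem_unit_sphere u)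
  have hmem : ∀ {x : Euc n}, inner ℝ (u : Euc n) x = 0 → x ∈ (ℝ ∙ (u : Euc n))ᗮ := fun hx =>
    Submodule.mem_orthogonal_singleton_iff_inner_right.2 hx
  have hspan : Submodule.span ℝ (Set.range e) = (ℝ ∙ (u : Euc n))ᗮ := by
    refine Submodule.eq_of_le_of_finrank_eq ?_ ?_
    · rw [Submodule.span_le]
      rintro _ ⟨i, rfl⟩
      exact hmem (he i)
    · rw [finrank_span_eq_card hli, hfin, Fintype.card_fin]
  obtain ⟨c, hc⟩ := (Submodule.mem_span_range_iff_exists_fun ℝ).1 (hspan ▸ hmem hτ)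
  have : ∀ j, B τ (e j) = c j := fun j => by rw [← hc, hcoef]
  simp only [this, hc]

/-- The eigenvalues of one bilinear form relative to another do not depend on the frame. -/
theorem meanCurv_eq_of_orthonormal (he : ∀ i, inner ℝ (u : Euc n) (e i) = 0)
    (hB : ∀ i j, B (e i) (e j) = if i = j then 1 else 0)
    (he' : ∀ i, inner ℝ (u : Euc n) (e' i) = 0)
    (hB' : ∀ i j, B (e' i) (e' j) = if i = j then 1 else 0) {l l' : Fin n → ℝ}
    (hS : ∀ i j, S (e i) (e j) = if i = j then l i else 0)
    (hS' : ∀ i j, S (e' i) (e' j) = if i = j then l' i else 0) (m : ℕ) :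
    meanCurv m l = meanCurv m l' := by
  set O : Matrix (Fin n) (Fin n) ℝ := Matrix.of fun i j => B (e' i) (e j) with hO
  have hexp : ∀ i, e' i = ∑ j, O i j • e j := fun i => eq_sum_of_orthonormal he hB (he' i)
  have h1 : O * O.transpose = 1 := by
    ext i k
    have := hB' i k
    rw [hexp i, hexp k] at this
    simp only [map_sum, LinearMap.sum_apply, map_smul, LinearMap.smul_apply, hB, smul_eq_mul,
      mul_ite, mul_one, mul_zero] at this
    simp only [Matrix.mul_apply, Matrix.transpose_apply, Matrix.one_apply]
    rw [← this]
    exact Finset.sum_congr rfl fun j _ => by simp [mul_comm]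
  have h2 : O * Matrix.diagonal l * O.transpose = Matrix.diagonal l' := by
    ext i k
    have := hS' i k
    rw [hexp i, hexp k] at this
    simp only [map_sum, LinearMap.sum_apply, map_smul, LinearMap.smul_apply, hS, smul_eq_mul,
      mul_ite, mul_zero] at this
    rw [Matrix.mul_apply, Matrix.diagonal_apply, ← this]
    refine Finset.sum_congr rfl fun j _ => ?_
    simp [Matrix.mul_diagonal]
    ring
  -- The diagonal matrices are orthogonally similar, so `l` and `l'` agree as multisets, and
  -- `meanCurv` depends only on the multiset.
  have h3 : (Matrix.diagonal l).charpoly = (Matrix.diagonal l').charpoly := by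
    rw [← h2, Matrix.mul_assoc, Matrix.charpoly_mul_comm, Matrix.mul_assoc,
      mul_eq_one_comm.1 h1, Matrix.mul_one]
  rw [Matrix.charpoly_diagonal, Matrix.charpoly_diagonal] at h3
  have h4 := congrArg Polynomial.roots h3
  rw [Polynomial.roots_prod _ _ (Finset.prod_ne_zero_iff.2 fun i _ => Polynomial.X_sub_C_ne_zero _),
    Polynomial.roots_prod _ _ (Finset.prod_ne_zero_iff.2 fun i _ => Polynomial.X_sub_C_ne_zero _)]
    at h4
  simp only [Polynomial.roots_X_sub_C, Multiset.bind_singleton] at h4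
  rw [meanCurv, meanCurv, ← Finset.esymm_map_val, ← Finset.esymm_map_val, h4]

/-- Admissibility and the equation each provide their own list of curvatures; this lets the equation
be used for the list that lies in `Γ_m`. -/
theorem IsPrincipalCurvatures.meanCurv_eq {K : SpaceForm} {z : Sph n → ℝ}
    (hzs : ContMDiff (𝓡 n) 𝓘(ℝ, ℝ) 2 z) (hz : z u ∈ K.radii) {l l' : Fin n → ℝ}
    (hl : IsPrincipalCurvatures K z u l) (hl' : IsPrincipalCurvatures K z u l') (m : ℕ) :
    meanCurv m l = meanCurv m l' := by
  obtain ⟨N, e, hN, he, hI, hII⟩ := hl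
  obtain ⟨N', e', hN', he', hI', hII'⟩ := hl'
  obtain rfl := hN.unique hzs hz hN'
  obtain ⟨S, hS⟩ := exists_secondFormBilin hz N
  simp only [← hS] at hII hII'
  exact meanCurv_eq_of_orthonormal (B := firstFormBilin K z u) he hI he' hI' hII hII' m

end Frames

/-! ### Exponential barriers on the sphere -/

/-- The existence of barriers for the strong maximum principle: a nonnegative function on the sphere
that vanishes somewhere but not identically is touched by small exponential barriers. -/
theorem exists_isLocalMin_sub_exp {n : ℕ} (hn : 1 ≤ n) {w : Sph n → ℝ} (hw : Continuous w)
    (h0 : ∀ u, 0 ≤ w u) (hz : ∃ u, w u = 0) (hnz : ∃ u, w u ≠ 0) :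
    ∃ p : Sph n, ∃ δ > 0, ∀ α > 0, ∀ η > 0, ∃ ε > 0, ∃ u : Sph n,
      IsLocalMin (fun v : Sph n => w v - ε * Real.exp (α * inner ℝ (v : Euc n) (p : Euc n))) u ∧
      δ ≤ 1 - inner ℝ (u : Euc n) (p : Euc n) ^ 2 ∧
      ε * α * Real.exp (α * inner ℝ (u : Euc n) (p : Euc n)) ≤ η ∧
      w u ≤ ε * Real.exp (α * inner ℝ (u : Euc n) (p : Euc n)) := by
  have hconn : PreconnectedSpace (Sph n) := by
    refine Subtype.preconnectedSpace (isPreconnected_sphere ?_ 0 1)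
    rw [← Module.finrank_eq_rank, finrank_euclideanSpace_fin]
    exact_mod_cast (show 1 < n + 1 by omega)
  have hs : ∀ p : Sph n, Continuous fun v : Sph n => inner ℝ (v : Euc n) (p : Euc n) := fun p => by
    fun_prop
  have hone : ∀ v p : Sph n, inner ℝ (v : Euc n) (p : Euc n) ≤ (1 : ℝ) := fun v p => by
    simpa using real_inner_le_norm (v : Euc n) (p : Euc n)
  set Z := {u | w u = 0} with hZ
  have hZc : IsClosed Z := isClosed_eq hw continuous_const
  have hZo : ¬ IsOpen Z := by
    intro ho
    rcases isClopen_iff.1 ⟨hZc, ho⟩ with h | h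
    · obtain ⟨u, hu⟩ := hz
      exact (h ▸ (show u ∈ Z from hu) : u ∈ (∅ : Set (Sph n)))
    · obtain ⟨u, hu⟩ := hnz
      exact hu (h ▸ Set.mem_univ u : u ∈ Z)
  obtain ⟨q₀, hq₀, hq₀'⟩ : ∃ q ∈ Z, Z ∉ 𝓝 q := by
    by_contra! h
    exact hZo (isOpen_iff_mem_nhds.2 h)
  obtain ⟨p, hp, hpZ⟩ : ∃ p : Sph n, 0 < inner ℝ (p : Euc n) (q₀ : Euc n) ∧ w p ≠ 0 := by
    by_contra! h
    refine hq₀' (mem_of_superset (IsOpen.mem_nhds (isOpen_lt continuous_const (hs q₀)) ?_) h)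
    simp
  refine ⟨p, ?_⟩
  -- `q₁` is the zero of `w` nearest to `p`. With `c'` halfway between `c` and `1`, the function `w`
  -- is positive on the closed cap `A` around `p`.
  obtain ⟨q₁, hq₁, hmax⟩ := hZc.isCompact.exists_isMaxOn ⟨q₀, hq₀⟩ (hs p).continuousOn
  set c := inner ℝ (q₁ : Euc n) (p : Euc n) with hc
  have hc0 : 0 < c := by
    have h1 : inner ℝ (q₀ : Euc n) (p : Euc n) ≤ c := hmax hq₀
    rw [real_inner_comm] at h1
    exact hp.trans_le h1
  have hc1 : c < 1 := by
    refine lt_of_le_of_ne (hone q₁ p) fun h => hpZ ?_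
    have : (q₁ : Euc n) = p := (inner_eq_one_iff_of_norm_eq_one (by simp) (by simp)).1 h
    rwa [← Subtype.ext this]
  set c' := (c + 1) / 2 with hc'
  -- The touching point will satisfy `0 < c ≤ s < c'`, whatever `α` is.
  refine ⟨1 - c' ^ 2, by nlinarith, fun α hα η hη => ?_⟩
  set A := {v : Sph n | c' ≤ inner ℝ (v : Euc n) (p : Euc n)} with hA
  have hAc : IsCompact A := (isClosed_le continuous_const (hs p)).isCompact
  have hpA : p ∈ A := by
    simp only [hA, Set.mem_ofPred_eq, real_inner_self_eq_norm_sq]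
    simp; linarith
  obtain ⟨a, haA, ha⟩ := hAc.exists_isMinOn ⟨p, hpA⟩ hw.continuousOn
  have hwa : 0 < w a := by
    refine lt_of_le_of_ne (h0 a) fun h => ?_
    have h1 : inner ℝ (a : Euc n) (p : Euc n) ≤ c := hmax (show w a = 0 from h.symm)
    have h2 : c' ≤ inner ℝ (a : Euc n) (p : Euc n) := haA
    linarith
  have hE := Real.exp_pos α
  -- The first entry makes the gradient of the barrier small; the second keeps the barrier below `w`
  -- on the cap.
  set ε := min (η / (α * Real.exp α)) (w a / (2 * Real.exp α)) with hε
  have hε0 : 0 < ε := lt_min (by positivity) (by positivity)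
  have hε1 : ε * α * Real.exp α ≤ η := by
    have := min_le_left (η / (α * Real.exp α)) (w a / (2 * Real.exp α))
    rw [← hε, le_div_iff₀ (by positivity)] at this
    linarith
  have hε2 : ε * Real.exp α < w a := by
    have := min_le_right (η / (α * Real.exp α)) (w a / (2 * Real.exp α))
    rw [← hε, le_div_iff₀ (by positivity)] at this
    linarith
  have hexp : ∀ v : Sph n, Real.exp (α * inner ℝ (v : Euc n) (p : Euc n)) ≤ Real.exp α := fun v =>
    Real.exp_le_exp.2 (by nlinarith [hone v p])
  set D := {v : Sph n | inner ℝ (v : Euc n) (p : Euc n) ≤ c'} with hD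
  have hDc : IsCompact D := (isClosed_le (hs p) continuous_const).isCompact
  have hq₁D : q₁ ∈ D := by
    change c ≤ c'
    linarith
  obtain ⟨u, huD, hu⟩ := hDc.exists_isMinOn ⟨q₁, hq₁D⟩
    (f := fun v : Sph n => w v - ε * Real.exp (α * inner ℝ (v : Euc n) (p : Euc n)))
    (by fun_prop)
  have hu1 := hu hq₁D
  simp only [Set.mem_ofPred_eq] at hu1
  rw [← hc, show w q₁ = 0 from hq₁] at hu1
  set s := inner ℝ (u : Euc n) (p : Euc n) with hsu
  -- The minimum over `D` is negative, as the value at `q₁` shows, whereas the function is positive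
  -- on `A`; hence it is attained off the boundary of `D`.
  have hlt : s < c' := by
    by_contra! h
    have h1 := ha (show u ∈ A from h)
    have h2 := mul_le_mul_of_nonneg_left (hexp u) hε0.le
    have h3 : 0 < ε * Real.exp (α * c) := by positivity
    simp only [Set.mem_ofPred_eq] at h1
    linarith
  -- For `s < c` the barrier at `u` is smaller than at `q₁`, so `w ≥ 0` makes the value at `u`
  -- exceed the one at `q₁`.
  have hge : c ≤ s := by
    by_contra! h
    have h1 : Real.exp (α * s) < Real.exp (α * c) := Real.exp_lt_exp.2 (by nlinarith)
    nlinarith [h0 u]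
  refine ⟨ε, hε0, u, ?_, ?_, ?_, ?_⟩
  · exact hu.isLocalMin (mem_of_superset
      ((isOpen_lt (hs p) continuous_const).mem_nhds (show s < c' from hlt))
      fun v (hv : inner ℝ (v : Euc n) (p : Euc n) < c') => hv.le)
  · nlinarith
  · exact (mul_le_mul_of_nonneg_left (hexp u) (by positivity)).trans hε1
  · have : 0 < ε * Real.exp (α * c) := by positivity
    linarith

/-! ### Lipschitz control of the right-hand side -/

/-- A function that is `C¹` up to the boundary on `Sⁿ × [R₁, R₂]` is locally Lipschitz in the second
variable, uniformly in the first. -/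
theorem exists_abs_sub_le_of_contMDiffOn {n : ℕ} {R₁ R₂ R : ℝ} (hR : R ∈ Set.Icc R₁ R₂)
    {ψ : Sph n → ℝ → ℝ}
    (hψ : ContMDiffOn ((𝓡 n).prod 𝓘(ℝ, ℝ)) 𝓘(ℝ, ℝ) ∞
      (fun x : Sph n × ℝ => ψ x.1 x.2) (Set.univ ×ˢ Set.Icc R₁ R₂)) :
    ∃ C > 0, ∃ d > 0, ∀ u, ∀ ρ ∈ Set.Icc R₁ R₂, |ρ - R| < d → |ψ u ρ - ψ u R| ≤ C * |ρ - R| := by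
  have key : ∃ C > 0, ∃ d > 0, ∀ u ∈ (Set.univ : Set (Sph n)), ∀ ρ ∈ Set.Icc R₁ R₂,
      |ρ - R| < d → |ψ u ρ - ψ u R| ≤ C * |ρ - R| := by
    refine isCompact_univ.induction_on (p := fun A => ∃ C > 0, ∃ d > 0, ∀ u ∈ A,
      ∀ ρ ∈ Set.Icc R₁ R₂, |ρ - R| < d → |ψ u ρ - ψ u R| ≤ C * |ρ - R|) ?_ ?_ ?_ ?_
    · exact ⟨1, one_pos, 1, one_pos, by simp⟩
    · rintro s t hst ⟨C, hC, d, hd, h⟩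
      exact ⟨C, hC, d, hd, fun u hu => h u (hst hu)⟩
    · rintro s t ⟨C, hC, d, hd, h⟩ ⟨C', hC', d', hd', h'⟩
      refine ⟨max C C', lt_max_of_lt_left hC, min d d', lt_min hd hd', ?_⟩
      rintro u (hu | hu) ρ hρ hlt
      · exact (h u hu ρ hρ (hlt.trans_le (min_le_left _ _))).trans
          (mul_le_mul_of_nonneg_right (le_max_left _ _) (abs_nonneg _))
      · exact (h' u hu ρ hρ (hlt.trans_le (min_le_right _ _))).trans
          (mul_le_mul_of_nonneg_right (le_max_right _ _) (abs_nonneg _))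
    · intro u₀ _
      have h1 := hψ (u₀, R) ⟨Set.mem_univ _, hR⟩
      rw [contMDiffWithinAt_iff] at h1
      obtain ⟨-, h2⟩ := h1
      set E := EuclideanSpace ℝ (Fin n)
      set φ := extChartAt (𝓡 n) u₀ with hφ
      have hset : (extChartAt ((𝓡 n).prod 𝓘(ℝ, ℝ)) (u₀, R)).symm ⁻¹' (Set.univ ×ˢ Set.Icc R₁ R₂)
          ∩ Set.range ((𝓡 n).prod 𝓘(ℝ, ℝ)) = (Set.univ : Set E) ×ˢ Set.Icc R₁ R₂ := by
        rw [ModelWithCorners.range_eq_univ, Set.inter_univ]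
        ext ⟨x, y⟩
        exact ⟨fun h => ⟨trivial, h.2⟩, fun h => ⟨trivial, h.2⟩⟩
      rw [hset] at h2
      -- In a chart the domain is the convex set `E × [R₁, R₂]`, so a `C¹` function is Lipschitz
      -- near `(u₀, R)` even when `R` is an endpoint.
      obtain ⟨L, t, ht, hL⟩ := (h2.of_le (m := 1) (by simp)).exists_lipschitzOnWith
        (convex_univ.prod (convex_Icc R₁ R₂))
      rw [show extChartAt ((𝓡 n).prod 𝓘(ℝ, ℝ)) (u₀, R) (u₀, R) = (φ u₀, R) from rfl,
        nhdsWithin_prod_eq, nhdsWithin_univ, mem_prod_iff] at ht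
      obtain ⟨t₁, ht₁, t₂, ht₂, hsub⟩ := ht
      obtain ⟨d, hd, hd'⟩ := Metric.mem_nhdsWithin_iff.1 ht₂
      refine ⟨φ ⁻¹' t₁ ∩ φ.source, ?_, L + 1, by positivity, d, hd, ?_⟩
      · rw [nhdsWithin_univ]
        exact inter_mem ((continuousAt_extChartAt u₀).preimage_mem_nhds ht₁)
          (extChartAt_source_mem_nhds u₀)
      · rintro u ⟨hu₁, hu₂⟩ ρ hρ hlt
        have hF : ∀ r, ψ (φ.symm (φ u)) r = ψ u r := fun r => by rw [φ.left_inv hu₂]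
        have hmem : ∀ r ∈ Set.Icc R₁ R₂, |r - R| < d → (φ u, r) ∈ t := fun r hr hr' =>
          hsub ⟨hu₁, hd' ⟨by rwa [Metric.mem_ball, Real.dist_eq], hr⟩⟩
        have h3 := hL.dist_le_mul _ (hmem ρ hρ hlt) _ (hmem R hR (by simpa using hd))
        change |ψ (φ.symm (φ u)) ρ - ψ (φ.symm (φ u)) R| ≤ _ at h3
        rw [hF, hF, Prod.dist_eq, dist_self, Real.dist_eq, max_eq_right (abs_nonneg _)] at h3
        nlinarith [abs_nonneg (ρ - R)]
  obtain ⟨C, hC, d, hd, h⟩ := key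
  exact ⟨C, hC, d, hd, fun u => h u (Set.mem_univ u)⟩

/-! ### Curvature comparison at a touching point and choice of the exponent -/

/-- Principal curvatures at a point where `σ z` is touched from below by an exponential barrier, with
`y i` the second derivatives of the barrier in the principal directions. -/
theorem IsPrincipalCurvatures.bounds_of_touching {n : ℕ} {K : SpaceForm} {z : Sph n → ℝ} {u : Sph n}
    (hzs : ContMDiff (𝓡 n) 𝓘(ℝ, ℝ) 2 z) (hz : z u ∈ K.radii) {l : Fin n → ℝ}
    (hl : IsPrincipalCurvatures K z u l) {p : Sph n} {σ g α : ℝ} (hσ : σ ^ 2 = 1) (hg : 0 < g)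
    (hα : 0 ≤ α)
    (h1 : ∀ ξ, inner ℝ (u : Euc n) ξ = 0 →
      σ * fderiv ℝ (fun y => z (sphProj y)) u ξ = g * inner ℝ ξ (p : Euc n))
    (h2 : ∀ ξ, inner ℝ (u : Euc n) ξ = 0 →
      g * (α * inner ℝ ξ (p : Euc n) ^ 2 - inner ℝ (u : Euc n) (p : Euc n) * ‖ξ‖ ^ 2)
        ≤ σ * fderiv ℝ (fderiv ℝ fun y => z (sphProj y)) u ξ ξ) :
    ∃ (b : ℝ) (y : Fin n → ℝ), 0 < b ∧ b ≤ 1 ∧ 1 - g ^ 2 / K.warp (z u) ≤ b ∧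
      (∀ i, |y i| ≤ (α + 1) / K.warp (z u)) ∧
      α * (1 - inner ℝ (u : Euc n) (p : Euc n) ^ 2) / (K.warp (z u) + g ^ 2) - n / K.warp (z u)
        ≤ ∑ i, y i ∧
      (σ = -1 → ∀ i, b * (K.cotan (z u) + g * y i) ≤ l i) ∧
      (σ = 1 → ∀ i, l i ≤ b * (K.cotan (z u) * (1 + g ^ 2 / K.warp (z u)) - g * y i)) := by
  obtain ⟨hz0, hW, hκ⟩ := K.pos_of_mem_radii hz
  obtain ⟨N, e, hN, he, hI, hII⟩ := hl
  set W := K.warp (z u)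
  set s := inner ℝ (u : Euc n) (p : Euc n) with hs
  set D := fun ξ => fderiv ℝ (fun y => z (sphProj y)) u ξ with hD
  have hDσ : ∀ ξ, inner ℝ (u : Euc n) ξ = 0 → D ξ = σ * g * inner ℝ ξ (p : Euc n) := fun ξ hξ => by
    linear_combination σ * h1 ξ hξ - D ξ * hσ
  have hp1 : ‖(p : Euc n)‖ = 1 := by simp
  have hu1 : ‖(u : Euc n)‖ = 1 := by simp
  have hq : ∀ ξ : Euc n, inner ℝ ξ (p : Euc n) ^ 2 ≤ ‖ξ‖ ^ 2 := fun ξ => by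
    have := abs_real_inner_le_norm ξ (p : Euc n)
    rw [hp1, mul_one] at this
    rw [← sq_abs]
    gcongr
  have hs1 : s ^ 2 ≤ 1 := by simpa [hu1] using hq (u : Euc n)
  obtain ⟨hs2, hs3⟩ := abs_le.1 ((sq_le_one_iff_abs_le_one s).1 hs1)
  have hgrad : ∀ ξ, inner ℝ (u : Euc n) ξ = 0 → |D ξ| ≤ g * ‖ξ‖ := fun ξ hξ => by
    refine abs_le_of_sq_le_sq ?_ (by positivity)
    rw [hDσ ξ hξ]
    calc _ = σ ^ 2 * g ^ 2 * inner ℝ ξ (p : Euc n) ^ 2 := by ring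
      _ ≤ 1 * g ^ 2 * ‖ξ‖ ^ 2 := by rw [hσ]; exact mul_le_mul_of_nonneg_left (hq ξ) (by positivity)
      _ = _ := by ring
  obtain ⟨hb0, hb1, hb2⟩ := hN.inner_bounds hzs hz hgrad
  have hI' : ∀ ξ η, inner ℝ (u : Euc n) ξ = 0 → inner ℝ (u : Euc n) η = 0 →
      firstForm K z u ξ η = W * inner ℝ ξ η
        + g ^ 2 * inner ℝ ξ (p : Euc n) * inner ℝ η (p : Euc n) := fun ξ η hξ hη => by
    have h3 := hDσ ξ hξ
    have h4 := hDσ η hη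
    simp only [hD] at h3 h4
    rw [firstForm_eq hzs hz hξ hη, h3, h4]
    linear_combination (g ^ 2 * inner ℝ ξ (p : Euc n) * inner ℝ η (p : Euc n)) * hσ
  have hen : ∀ i, W * ‖e i‖ ^ 2 + g ^ 2 * inner ℝ (e i) (p : Euc n) ^ 2 = 1 := fun i => by
    have h3 := hI i i
    rw [hI' _ _ (he i) (he i), if_pos rfl, real_inner_self_eq_norm_sq] at h3
    linear_combination h3
  have hen' : ∀ i, ‖e i‖ ^ 2 ≤ 1 / W := fun i => by
    rw [le_div_iff₀ hW]
    nlinarith [hen i, mul_nonneg (sq_nonneg g) (sq_nonneg (inner ℝ (e i) (p : Euc n) : ℝ))]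
  set q := fun i => (inner ℝ (e i) (p : Euc n) : ℝ) with hqdef
  set y := fun i => α * q i ^ 2 - s * ‖e i‖ ^ 2 with hy
  -- Parseval's identity for the tangential part of `p`
  have hpars : (W + g ^ 2 * (1 - s ^ 2)) * ∑ i, q i ^ 2 = 1 - s ^ 2 := by
    set τ := (p : Euc n) - s • (u : Euc n) with hτ
    have hτu : inner ℝ (u : Euc n) τ = 0 := by
      rw [hτ, inner_sub_right, real_inner_smul_right, inner_coe_self, ← hs]; ring
    have hτp : inner ℝ τ (p : Euc n) = 1 - s ^ 2 := by
      rw [hτ, inner_sub_left, real_inner_smul_left, inner_coe_self, ← hs]; ring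
    have hτe : ∀ i, inner ℝ τ (e i) = q i := fun i => by
      rw [hτ, inner_sub_left, real_inner_smul_left, he i, real_inner_comm]; ring
    have h3 := eq_sum_of_orthonormal (B := firstFormBilin K z u) he hI hτu
    have h4 : ∀ i, firstFormBilin K z u τ (e i) = (W + g ^ 2 * (1 - s ^ 2)) * q i := fun i => by
      rw [firstFormBilin_apply, hI' _ _ hτu (he i), hτe, hτp]; ring
    simp only [h4] at h3
    have h5 := congrArg (fun v => (inner ℝ v (p : Euc n) : ℝ)) h3
    simp only [sum_inner, real_inner_smul_left] at h5
    rw [hτp] at h5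
    rw [Finset.mul_sum]
    refine Eq.trans ?_ h5.symm
    exact Finset.sum_congr rfl fun i _ => by simp only [hqdef]; ring
  have hl : ∀ i, l i = -inner ℝ N (u : Euc n) * (K.cotan (z u) * (1 + D (e i) ^ 2)
      - fderiv ℝ (fderiv ℝ fun y => z (sphProj y)) u (e i) (e i)) := fun i => by
    have h3 := hII i i
    rw [if_pos rfl, secondForm_self_eq hzs hz hN (he i), hI i i, if_pos rfl] at h3
    exact h3.symm
  refine ⟨-inner ℝ N (u : Euc n), y, hb0, hb1, hb2, fun i => ?_, ?_, ?_, ?_⟩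
  · have h3 := hen' i
    have h4 := (hq (e i)).trans h3
    have h5 : 0 ≤ ‖e i‖ ^ 2 := sq_nonneg _
    have h6 : (α + 1) / W = α * (1 / W) + 1 / W := by ring
    have h7 : 0 ≤ α * q i ^ 2 := by positivity
    have h8 : α * q i ^ 2 ≤ α * (1 / W) := mul_le_mul_of_nonneg_left h4 hα
    rw [h6, abs_le]
    simp only [hy]
    constructor <;> nlinarith
  · have h3 : ∑ i, y i = α * ∑ i, q i ^ 2 - s * ∑ i, ‖e i‖ ^ 2 := by
      simp only [hy, Finset.sum_sub_distrib, Finset.mul_sum]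
    have h4 : ∑ i, ‖e i‖ ^ 2 ≤ n / W := by
      refine (Finset.sum_le_sum fun i _ => hen' i).trans_eq ?_
      simp [div_eq_mul_inv]
    have h5 : 0 ≤ ∑ i, ‖e i‖ ^ 2 := Finset.sum_nonneg fun i _ => sq_nonneg _
    -- Parseval gives the sum exactly; its denominator `W + g ^ 2 * (1 - s ^ 2)` is at most `W + g ^
    -- 2`.
    have h6 : (1 - s ^ 2) / (W + g ^ 2) ≤ ∑ i, q i ^ 2 := by
      rw [div_le_iff₀ (by positivity), ← hpars, mul_comm]
      have h7 : 0 ≤ ∑ i, q i ^ 2 := Finset.sum_nonneg fun i _ => sq_nonneg _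
      refine mul_le_mul_of_nonneg_left ?_ h7
      nlinarith [mul_nonneg (sq_nonneg g) (sq_nonneg s)]
    rw [h3, mul_div_assoc]
    have h7 := mul_le_mul_of_nonneg_left h6 hα
    nlinarith
  · intro hσ' i
    rw [hl i]
    refine mul_le_mul_of_nonneg_left ?_ hb0.le
    have h3 := h2 (e i) (he i)
    rw [hσ'] at h3
    have h4 : 0 ≤ K.cotan (z u) * D (e i) ^ 2 := by positivity
    simp only [hy, hqdef]
    linarith
  · intro hσ' i
    rw [hl i]
    refine mul_le_mul_of_nonneg_left ?_ hb0.le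
    have h3 := h2 (e i) (he i)
    rw [hσ'] at h3
    have h4 : D (e i) ^ 2 ≤ g ^ 2 / W := by
      rw [hDσ _ (he i), div_eq_mul_one_div]
      calc _ = σ ^ 2 * g ^ 2 * inner ℝ (e i) (p : Euc n) ^ 2 := by ring
        _ ≤ 1 * g ^ 2 * (1 / W) := by 
          rw [hσ]; exact mul_le_mul_of_nonneg_left ((hq _).trans (hen' i)) (by positivity)
        _ = _ := by ring
    have h5 := mul_le_mul_of_nonneg_left h4 hκ.le
    simp only [hy, hqdef]
    linarith

/-- For a barrier of sufficiently large exponent and small size `g`, principal curvatures bounded below by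
those of the barrier have `H_m > κ ^ m + C g`. -/
theorem exists_add_le_meanCurv {n m : ℕ} (hm : 1 ≤ m) (hmn : m ≤ n) {κ w f δ C : ℝ} (hκ : 0 < κ)
    (hw : 0 < w) (hf : 0 < f) (hδ : 0 < δ) :
    ∃ α ≥ 1, ∃ g₀ > 0, ∀ g, 0 < g → g ≤ g₀ → ∀ (b : ℝ) (y l : Fin n → ℝ),
      1 - g ^ 2 * w ≤ b → (∀ i, |y i| ≤ (α + 1) * w) →
      α * δ / (f + g ^ 2) - n * w ≤ ∑ i, y i → (∀ i, b * (κ + g * y i) ≤ l i) →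
      κ ^ m + C * g < meanCurv m l := by
  have hn : (0 : ℝ) < n := Nat.cast_pos.2 (by omega)
  have hm' : (0 : ℝ) < m := Nat.cast_pos.2 hm
  set A := κ ^ m * (m / n) with hA
  have hA0 : 0 < A := by positivity
  -- For `g ≤ 1` this forces `∑ i, y i ≥ κ * (C / A + 2)`. Of the summand `2`, one unit absorbs the
  -- quadratic errors and the other gives strict inequality.
  obtain ⟨α, hα1, hα⟩ : ∃ α ≥ 1, κ * (C / A + 2) + n * w ≤ α * δ / (f + 1) := by
    refine ⟨max 1 ((κ * (C / A + 2) + n * w) * (f + 1) / δ), le_max_left _ _, ?_⟩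
    rw [le_div_iff₀ (by positivity), ← div_le_iff₀ hδ]
    exact le_max_right _ _
  set Y := (α + 1) * w with hY
  have hY0 : 0 < Y := by positivity
  set T := Y / κ + 2 * w with hT
  have hT0 : 0 < T := by positivity
  -- The four bounds give, in order, `g ^ 2 ≤ g`, `0 ≤ κ + g * y i ≤ 2 * κ`, `|x i| ≤ 1 / 2`, and a
  -- total quadratic error of at most `g`.
  refine ⟨α, hα1, min (min 1 (κ / Y)) (min (1 / (2 * T)) (1 / (2 * n * (w + T ^ 2)))),
    by positivity, fun g hg hg₀ b y l hb hy hsum hl => ?_⟩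
  have hg1 : g ≤ 1 := hg₀.trans ((min_le_left _ _).trans (min_le_left _ _))
  have hg2 : g * Y ≤ κ := (le_div_iff₀ hY0).1
    (hg₀.trans ((min_le_left _ _).trans (min_le_right _ _)))
  have hg3 : g * (2 * T) ≤ 1 := (le_div_iff₀ (by positivity)).1
    (hg₀.trans ((min_le_right _ _).trans (min_le_left _ _)))
  have hg4 : g * (2 * n * (w + T ^ 2)) ≤ 1 := (le_div_iff₀ (by positivity)).1
    (hg₀.trans ((min_le_right _ _).trans (min_le_right _ _)))
  -- The correction `2 * w * g ^ 2` pays for `b` possibly being as small as `1 - g ^ 2 * w`.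
  set x := fun i => g * y i / κ - 2 * w * g ^ 2 with hx
  have hgy : ∀ i, |g * y i| ≤ g * Y := fun i => by
    rw [abs_mul, abs_of_pos hg]
    exact mul_le_mul_of_nonneg_left (hy i) hg.le
  have hgg : g ^ 2 ≤ g := by nlinarith
  have hxT : ∀ i, |x i| ≤ g * T := fun i => by
    have h1 : |g * y i / κ| ≤ g * Y / κ := by
      rw [abs_div, abs_of_pos hκ]
      gcongr
      exact hgy i
    have h2 : |2 * w * g ^ 2| ≤ 2 * w * g := by
      rw [abs_of_nonneg (by positivity)]
      gcongr
    calc |x i| ≤ |g * y i / κ| + |2 * w * g ^ 2| := abs_sub _ _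
      _ ≤ g * Y / κ + 2 * w * g := add_le_add h1 h2
      _ = g * T := by rw [hT]; ring
  have hx2 : ∀ i, |x i| ≤ 1 / 2 := fun i => (hxT i).trans (by linarith)
  have hlow : ∀ i, κ * (1 + x i) ≤ l i := fun i => by
    refine le_trans ?_ (hl i)
    obtain ⟨h1, h2⟩ := abs_le.1 (hgy i)
    have h3 : 0 ≤ κ + g * y i := by linarith
    have h4 : (1 - g ^ 2 * w) * (κ + g * y i) ≤ b * (κ + g * y i) :=
      mul_le_mul_of_nonneg_right hb h3
    have h5 : g ^ 2 * w * (κ + g * y i) ≤ g ^ 2 * w * (2 * κ) :=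
      mul_le_mul_of_nonneg_left (by linarith) (by positivity)
    have h6 : κ * (1 + x i) = κ + g * y i - 2 * w * g ^ 2 * κ := by
      simp only [hx]; field_simp; ring
    rw [h6]; linarith
  have h0 : ∀ i, 0 ≤ κ * (1 + x i) := fun i => by
    have := (abs_le.1 (hx2 i)).1
    exact mul_nonneg hκ.le (by linarith)
  refine lt_of_lt_of_le ?_ ((le_meanCurv_of_abs_le hm hmn hκ.le hx2).trans (meanCurv_mono h0 hlow))
  have hS : g * (C / A + 1) ≤ ∑ i, (x i - 2 * x i ^ 2) := by
    have h1 : ∀ i, x i - 2 * (g * T) ^ 2 ≤ x i - 2 * x i ^ 2 := fun i => by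
      have : x i ^ 2 ≤ (g * T) ^ 2 := sq_le_sq.2 ((hxT i).trans (le_abs_self _))
      linarith
    have h2 : ∑ i, (x i - 2 * (g * T) ^ 2)
        = g * ((∑ i, y i) / κ) - g * (g * (2 * n * (w + T ^ 2))) := by
      simp only [hx, Finset.sum_sub_distrib, ← Finset.mul_sum, ← Finset.sum_div, Finset.sum_const,
        Finset.card_univ, Fintype.card_fin, nsmul_eq_mul]
      ring
    have h3 : α * δ / (f + 1) ≤ α * δ / (f + g ^ 2) := by
      gcongr
      nlinarith
    have h4 : C / A + 2 ≤ (∑ i, y i) / κ := by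
      rw [le_div_iff₀ hκ]
      linarith
    have h5 := Finset.sum_le_sum fun i (_ : i ∈ Finset.univ) => h1 i
    rw [h2] at h5
    nlinarith
  have h6 : κ ^ m * (1 + m / n * ∑ i, (x i - 2 * x i ^ 2))
      = κ ^ m + A * ∑ i, (x i - 2 * x i ^ 2) := by rw [hA]; ring
  have h7 := mul_le_mul_of_nonneg_left hS hA0.le
  have h8 : A * (g * (C / A + 1)) = C * g + A * g := by field_simp
  rw [h6]
  nlinarith [mul_pos hA0 hg]

/-- For a barrier of sufficiently large exponent and small size `g`, principal curvatures bounded above by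
those of the barrier have `H_1 ^ m < κ ^ m - C g`. -/
theorem exists_meanCurv_one_pow_lt {n m : ℕ} (hm : 1 ≤ m) (hn : 1 ≤ n) {κ w f δ C : ℝ}
    (hκ : 0 < κ) (hw : 0 < w) (hf : 0 < f) (hδ : 0 < δ) (hC : 0 ≤ C) :
    ∃ α ≥ 1, ∃ g₀ > 0, ∀ g, 0 < g → g ≤ g₀ → ∀ (b : ℝ) (y l : Fin n → ℝ),
      b ≤ 1 → (∀ i, |y i| ≤ (α + 1) * w) →
      α * δ / (f + g ^ 2) - n * w ≤ ∑ i, y i →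
      (∀ i, l i ≤ b * (κ * (1 + g ^ 2 * w) - g * y i)) → 0 < meanCurv 1 l →
      meanCurv 1 l ^ m < κ ^ m - C * g := by
  have hn' : (0 : ℝ) < n := Nat.cast_pos.2 (by omega)
  set A := κ ^ (m - 1) with hA
  have hA0 : 0 < A := by positivity
  -- The term `κ * w` offsets the gradient contribution to the curvatures, and `1` makes the final
  -- inequality strict.
  obtain ⟨α, hα1, hα⟩ : ∃ α ≥ 1, n * (C / A + κ * w + 1) + n * w ≤ α * δ / (f + 1) := by
    refine ⟨max 1 ((n * (C / A + κ * w + 1) + n * w) * (f + 1) / δ), le_max_left _ _, ?_⟩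
    rw [le_div_iff₀ (by positivity), ← div_le_iff₀ hδ]
    exact le_max_right _ _
  set Y := (α + 1) * w with hY
  have hY0 : 0 < Y := by positivity
  refine ⟨α, hα1, min 1 (κ / Y), by positivity, fun g hg hg₀ b y l hb hy hsum hl hpos => ?_⟩
  have hg1 : g ≤ 1 := hg₀.trans (min_le_left _ _)
  have hg2 : g * Y ≤ κ := (le_div_iff₀ hY0).1 (hg₀.trans (min_le_right _ _))
  have hgg : g ^ 2 ≤ g := by nlinarith
  have hup : ∀ i, l i ≤ κ + κ * w * g - g * y i := fun i => by
    refine (hl i).trans ?_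
    have h1 : g * y i ≤ g * Y := mul_le_mul_of_nonneg_left (abs_le.1 (hy i)).2 hg.le
    have h2 : 0 ≤ κ * (g ^ 2 * w) := by positivity
    have h3 : 0 ≤ κ * (1 + g ^ 2 * w) - g * y i := by linarith
    have h4 : κ * w * g ^ 2 ≤ κ * w * g := by gcongr
    nlinarith [mul_le_mul_of_nonneg_right hb h3]
  have h1 : meanCurv 1 l ≤ κ - g * (C / A + 1) := by
    rw [meanCurv_one, inv_mul_le_iff₀ hn']
    refine (Finset.sum_le_sum fun i _ => hup i).trans ?_
    rw [Finset.sum_sub_distrib, ← Finset.mul_sum]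
    simp only [Finset.sum_const, Finset.card_univ, Fintype.card_fin, nsmul_eq_mul]
    have h3 : α * δ / (f + 1) ≤ α * δ / (f + g ^ 2) := by
      gcongr
      nlinarith
    have h4 : n * (C / A + κ * w + 1) ≤ ∑ i, y i := by linarith
    have h5 := mul_le_mul_of_nonneg_left h4 hg.le
    linarith
  have h2 : 0 ≤ C / A := by positivity
  have h3 : meanCurv 1 l ≤ κ := by nlinarith
  -- Only one factor has to carry the gain; the others are bounded by `κ`, as `0 < H_1 ≤ κ`.
  calc meanCurv 1 l ^ m = meanCurv 1 l ^ (m - 1) * meanCurv 1 l := by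
        rw [← pow_succ, Nat.sub_add_cancel hm]
    _ ≤ A * (κ - g * (C / A + 1)) := by
        rw [hA]
        gcongr
    _ = κ ^ m - C * g - A * g := by
        have h4 : A * κ = κ ^ m := by rw [hA, ← pow_succ, Nat.sub_add_cancel hm]
        rw [← h4]
        field_simp
        ring
    _ < κ ^ m - C * g := by nlinarith [mul_pos hA0 hg]

theorem SpaceForm.continuous_warp (K : SpaceForm) : Continuous K.warp := by
  cases K
  · exact Real.continuous_sinh.pow 2
  · exact Real.continuous_sin.pow 2

theorem SpaceForm.exists_warp_bounds {K : SpaceForm} {R₁ R₂ : ℝ} (hR₁ : R₁ ∈ K.radii)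
    (hR₂ : R₂ ∈ K.radii) (hR : R₁ ≤ R₂) :
    ∃ w > 0, ∃ f > 0, ∀ ρ ∈ Set.Icc R₁ R₂, 0 < K.warp ρ ∧ 1 / K.warp ρ ≤ w ∧ K.warp ρ ≤ f := by
  have hne : (Set.Icc R₁ R₂).Nonempty := Set.nonempty_Icc.2 hR
  obtain ⟨a, ha, hmin⟩ := isCompact_Icc.exists_isMinOn hne K.continuous_warp.continuousOn
  obtain ⟨b, hb, hmax⟩ := isCompact_Icc.exists_isMaxOn hne K.continuous_warp.continuousOn
  have hpos : ∀ ρ ∈ Set.Icc R₁ R₂, 0 < K.warp ρ := fun ρ hρ =>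
    (K.pos_of_mem_radii (K.Icc_subset_radii hR₁ hR₂ hρ)).2.1
  exact ⟨1 / K.warp a, one_div_pos.2 (hpos a ha), K.warp b, hpos b hb, fun ρ hρ =>
    ⟨hpos ρ hρ, one_div_le_one_div_of_le (hpos a ha) (hmin hρ), hmax hρ⟩⟩

/-- Touching by barriers of arbitrarily small size `g`, in terms of the derivatives of `z`. -/
theorem exists_touching {n : ℕ} (hn : 1 ≤ n) {z : Sph n → ℝ}
    (hz : ContMDiff (𝓡 n) 𝓘(ℝ, ℝ) 2 z) {σ R : ℝ} (hσ : σ ≠ 0) (h0 : ∀ u, 0 ≤ σ * (z u - R))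
    (h1 : ∃ u, z u = R) (h2 : ∃ u, z u ≠ R) :
    ∃ p : Sph n, ∃ δ > 0, ∀ α ≥ 1, ∀ η > 0, ∃ g > 0, g ≤ η ∧ ∃ u : Sph n,
      σ * (z u - R) ≤ g ∧ δ ≤ 1 - inner ℝ (u : Euc n) (p : Euc n) ^ 2 ∧
      (∀ ξ, inner ℝ (u : Euc n) ξ = 0 →
        σ * fderiv ℝ (fun y => z (sphProj y)) u ξ = g * inner ℝ ξ (p : Euc n)) ∧
      ∀ ξ, inner ℝ (u : Euc n) ξ = 0 →
        g * (α * inner ℝ ξ (p : Euc n) ^ 2 - inner ℝ (u : Euc n) (p : Euc n) * ‖ξ‖ ^ 2)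
          ≤ σ * fderiv ℝ (fderiv ℝ fun y => z (sphProj y)) u ξ ξ := by
  have hw : Continuous fun u => σ * (z u - R) := by
    have := hz.continuous
    fun_prop
  obtain ⟨p, δ, hδ, h⟩ := exists_isLocalMin_sub_exp hn hw h0
    (h1.imp fun u hu => by simp [hu]) (h2.imp fun u hu => mul_ne_zero hσ (sub_ne_zero.2 hu))
  refine ⟨p, δ, hδ, fun α hα η hη => ?_⟩
  have hα0 : 0 < α := by linarith
  obtain ⟨ε, hε, u, hmin, hδu, hεη, hwu⟩ := h α hα0 η hη
  have hE := Real.exp_pos (α * inner ℝ (u : Euc n) (p : Euc n))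
  refine ⟨ε * α * Real.exp (α * inner ℝ (u : Euc n) (p : Euc n)), by positivity, hεη, u, ?_, hδu,
    fun ξ hξ => (deriv_of_isLocalMin_sub_exp hz hξ hmin).1,
    fun ξ hξ => (deriv_of_isLocalMin_sub_exp hz hξ hmin).2⟩
  -- Since `α ≥ 1`, the height `ε exp (α ⟨u, p⟩)` of the barrier is at most `g`.
  refine hwu.trans ?_
  rw [mul_right_comm]
  exact le_mul_of_one_le_right (by positivity) hα

/-! ### The strong maximum principle at the two spheres -/

variable {K : SpaceForm} {n m : ℕ} {R₁ R₂ : ℝ} {ψ : Sph n → ℝ → ℝ} {z : Sph n → ℝ}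

/-- The strong maximum principle at the outer barrier sphere. -/
theorem eq_right_of_exists_eq_right (hm : 1 ≤ m) (hmn : m ≤ n)
    (hR₁ : R₁ ∈ K.radii) (hR₂ : R₂ ∈ K.radii) (hR : R₁ < R₂)
    (hψ_smooth : ContMDiffOn ((𝓡 n).prod 𝓘(ℝ, ℝ)) 𝓘(ℝ, ℝ) ∞
      (fun x : Sph n × ℝ => ψ x.1 x.2) (Set.univ ×ˢ Set.Icc R₁ R₂))
    (hψ₂ : ∀ u, ψ u R₂ ≤ K.cotan R₂ ^ m)
    (hz : ContMDiff (𝓡 n) 𝓘(ℝ, ℝ) 2 z) (hz_eq : SolvesCurvatureEq K m ψ z)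
    (hz_mem : ∀ u, z u ∈ Set.Icc R₁ R₂) (h : ∃ u, z u = R₂) : ∀ u, z u = R₂ := by
  by_contra! hne
  obtain ⟨w, hw, f, hf, hwf⟩ := K.exists_warp_bounds hR₁ hR₂ hR.le
  obtain ⟨C, hC, d, hd, hψ⟩ := exists_abs_sub_le_of_contMDiffOn (Set.right_mem_Icc.2 hR.le) hψ_smooth
  obtain ⟨p, δ, hδ, htouch⟩ := exists_touching (hm.trans hmn) hz (σ := -1) (R := R₂) (by norm_num)
    (fun u => by linarith [(hz_mem u).2]) h hne
  obtain ⟨α, hα, g₀, hg₀, hbar⟩ := exists_add_le_meanCurv (C := C) hm hmn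
    (K.pos_of_mem_radii hR₂).2.2 hw hf hδ
  obtain ⟨g, hg, hgη, u, hzu, hδu, h1, h2⟩ := htouch α hα (min g₀ (d / 2)) (by positivity)
  have hzr := K.Icc_subset_radii hR₁ hR₂ (hz_mem u)
  obtain ⟨hW, hWw, hWf⟩ := hwf _ (hz_mem u)
  obtain ⟨l, hl, hlψ⟩ := hz_eq u
  have hα0 : 0 ≤ α := by linarith
  obtain ⟨b, y, hb0, hb1, hb2, hy, hsum, hlow, -⟩ :=
    hl.bounds_of_touching hz hzr (by norm_num) hg hα0 h1 h2
  have hκ := K.cotan_anti hzr hR₂ (hz_mem u).2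
  have hlt := hbar g hg (hgη.trans (min_le_left _ _)) b y l ?_ ?_ ?_ ?_
  -- The equation gives `H_m = ψ u (z u) ≤ κ(R₂) ^ m + C g`, against the strict lower bound `hlt`.
  -- The bound `g ≤ d / 2` keeps `z u` in the Lipschitz range.
  · have h3 : |z u - R₂| ≤ g := by
      rw [abs_of_nonpos (by linarith [(hz_mem u).2])]; linarith
    have h4 := (abs_le.1 (hψ u (z u) (hz_mem u)
      (by linarith [hgη.trans (min_le_right _ _)]))).2
    have h5 := mul_le_mul_of_nonneg_left h3 hC.le
    linarith [hψ₂ u]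
  · refine le_trans ?_ hb2
    rw [div_eq_mul_one_div]
    gcongr
  · intro i
    refine (hy i).trans ?_
    rw [div_eq_mul_one_div]
    gcongr
  · refine le_trans ?_ hsum
    have h3 : (n : ℝ) / K.warp (z u) ≤ n * w := by
      rw [div_eq_mul_one_div]
      gcongr
    have h4 : α * δ / (f + g ^ 2) ≤
        α * (1 - inner ℝ (u : Euc n) (p : Euc n) ^ 2) / (K.warp (z u) + g ^ 2) := by
      gcongr
      exact mul_nonneg hα0 (hδ.le.trans hδu)
    linarith
  · intro i
    refine le_trans ?_ (hlow rfl i)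
    gcongr

/-- The strong maximum principle at the inner barrier sphere. -/
theorem eq_left_of_exists_eq_left (hm : 1 ≤ m) (hmn : m ≤ n)
    (hR₁ : R₁ ∈ K.radii) (hR₂ : R₂ ∈ K.radii) (hR : R₁ < R₂)
    (hψ_smooth : ContMDiffOn ((𝓡 n).prod 𝓘(ℝ, ℝ)) 𝓘(ℝ, ℝ) ∞
      (fun x : Sph n × ℝ => ψ x.1 x.2) (Set.univ ×ˢ Set.Icc R₁ R₂))
    (hψ₁ : ∀ u, K.cotan R₁ ^ m ≤ ψ u R₁)
    (hz : IsAdmissible K m z) (hz_eq : SolvesCurvatureEq K m ψ z)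
    (hz_mem : ∀ u, z u ∈ Set.Icc R₁ R₂) (h : ∃ u, z u = R₁) : ∀ u, z u = R₁ := by
  by_contra! hne
  obtain ⟨w, hw, f, hf, hwf⟩ := K.exists_warp_bounds hR₁ hR₂ hR.le
  obtain ⟨C, hC, d, hd, hψ⟩ := exists_abs_sub_le_of_contMDiffOn (Set.left_mem_Icc.2 hR.le) hψ_smooth
  obtain ⟨p, δ, hδ, htouch⟩ := exists_touching (hm.trans hmn) hz.contMDiff (σ := 1) (R := R₁)
    (by norm_num) (fun u => by linarith [(hz_mem u).1]) h hne
  obtain ⟨α, hα, g₀, hg₀, hbar⟩ := exists_meanCurv_one_pow_lt hm (hm.trans hmn)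
    (K.pos_of_mem_radii hR₁).2.2 hw hf hδ hC.le
  obtain ⟨g, hg, hgη, u, hzu, hδu, h1, h2⟩ := htouch α hα (min g₀ (d / 2)) (by positivity)
  have hzr := K.Icc_subset_radii hR₁ hR₂ (hz_mem u)
  obtain ⟨hW, hWw, hWf⟩ := hwf _ (hz_mem u)
  obtain ⟨l', hl', hlψ⟩ := hz_eq u
  obtain ⟨l, hl, hcone⟩ := hz.mem_cone u
  rw [hl'.meanCurv_eq hz.contMDiff hzr hl] at hlψ
  have hα0 : 0 ≤ α := by linarith
  obtain ⟨b, y, hb0, hb1, hb2, hy, hsum, -, hup⟩ :=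
    hl.bounds_of_touching hz.contMDiff hzr (by norm_num) hg hα0 h1 h2
  have hκ := K.cotan_anti hR₁ hzr (hz_mem u).1
  have hκ₁ := (K.pos_of_mem_radii hR₁).2.2
  have hlt := hbar g hg (hgη.trans (min_le_left _ _)) b y l hb1 ?_ ?_ ?_
    (meanCurv_pos_of_mem_gammaCone hmn hcone 1 hm)
  -- Here `κ(R₁) ^ m - C g ≤ ψ u (z u) = H_m ≤ H_1 ^ m`, against the strict upper bound `hlt`.
  · have h3 : |z u - R₁| ≤ g := by
      rw [abs_of_nonneg (by linarith [(hz_mem u).1])]; linarith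
    have h4 := (abs_le.1 (hψ u (z u) (hz_mem u)
      (by linarith [hgη.trans (min_le_right _ _)]))).1
    have h5 := mul_le_mul_of_nonneg_left h3 hC.le
    linarith [hψ₁ u, meanCurv_le_meanCurv_one_pow hm hmn hcone]
  · intro i
    refine (hy i).trans ?_
    rw [div_eq_mul_one_div]
    gcongr
  · refine le_trans ?_ hsum
    have h3 : (n : ℝ) / K.warp (z u) ≤ n * w := by
      rw [div_eq_mul_one_div]
      gcongr
    have h4 : α * δ / (f + g ^ 2) ≤
        α * (1 - inner ℝ (u : Euc n) (p : Euc n) ^ 2) / (K.warp (z u) + g ^ 2) := by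
      gcongr
      exact mul_nonneg hα0 (hδ.le.trans hδu)
    linarith
  · intro i
    refine (hup rfl i).trans ?_
    rw [div_eq_mul_one_div]
    gcongr

end

theorem lemma4p1 (K : SpaceForm) (n m : ℕ) (hm : 1 ≤ m) (hmn : m ≤ n)
    (R₁ R₂ : ℝ) (hR₁ : R₁ ∈ K.radii) (hR₂ : R₂ ∈ K.radii) (hR : R₁ < R₂)
    (ψ : Sph n → ℝ → ℝ)
    (hψ_smooth : ContMDiffOn ((𝓡 n).prod 𝓘(ℝ, ℝ)) 𝓘(ℝ, ℝ) ∞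
      (fun x : Sph n × ℝ => ψ x.1 x.2) (Set.univ ×ˢ Set.Icc R₁ R₂))
    (hψ_pos : ∀ u, ∀ ρ ∈ Set.Icc R₁ R₂, 0 < ψ u ρ)
    (hψ₁ : ∀ u, K.cotan R₁ ^ m ≤ ψ u R₁)
    (hψ₂ : ∀ u, ψ u R₂ ≤ K.cotan R₂ ^ m)
    (z : Sph n → ℝ) (hz : IsAdmissible K m z) (hz_eq : SolvesCurvatureEq K m ψ z)
    (hz_mem : ∀ u, z u ∈ Set.Icc R₁ R₂) :
    (∀ u, z u = R₁) ∨ (∀ u, z u = R₂) ∨ (∀ u, R₁ < z u ∧ z u < R₂) := by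
  by_cases h₁ : ∃ u, z u = R₁
  · exact Or.inl (eq_left_of_exists_eq_left hm hmn hR₁ hR₂ hR hψ_smooth hψ₁ hz hz_eq hz_mem h₁)
  by_cases h₂ : ∃ u, z u = R₂
  · exact Or.inr (Or.inl (eq_right_of_exists_eq_right hm hmn hR₁ hR₂ hR hψ_smooth hψ₂ hz.contMDiff
      hz_eq hz_mem h₂))
  push Not at h₁ h₂
  exact Or.inr (Or.inr fun u => ⟨lt_of_le_of_ne (hz_mem u).1 (h₁ u).symm,
    lt_of_le_of_ne (hz_mem u).2 (h₂ u)⟩)
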